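/- Let $\Phi_1=\{q^2 : q \text{ a prime power},\ q\equiv 1 \pmod 4\}$, $\Phi_2=\{n^4 : n\in\mathbb N \text{ odd}\}\cup\{9n^4 : n\in\mathbb N\text{ odd}\}$ and $\Phi_3=\{5\}$. A family $(B_1,\dots,B_\ell)$ of subsets of a finite additively written abelian group $G$ (repetitions allowed), with $|B_i|=k_i$, is a difference family with parameters $(|G|;k_1,\dots,k_\ell;\lambda)$ if every nonzero $g\in G$ is represented exactly $\lambda$ times in the list of differences $x-y$, $x,y\in B_i$, $x\neq y$, $i=1,\dots,\ell$. It is of type $H_4^*$ if $\ell=4$ and $\sum_{i=1}^4 k_i-(|G|+1)=\lambda$. Theorem. For every $v\in\Phi_1\cup\Phi_2\cup\Phi_3$ there exists an abelian group $G$ of order $5v$ and a difference family of type $H_4^*$ in $G$. -/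

import Mathlib

/-- `Φ₁ = {q² : q ≡ 1 (mod 4) is a prime power}`. -/
def Phi1 : Set ℕ := {v | ∃ q : ℕ, IsPrimePow q ∧ q ≡ 1 [MOD 4] ∧ v = q ^ 2}

/-- `Φ₂ = {n⁴ : n odd} ∪ {9n⁴ : n odd}`. -/
def Phi2 : Set ℕ :=
  {v | ∃ n : ℕ, n ≡ 1 [MOD 2] ∧ v = n ^ 4} ∪ {v | ∃ n : ℕ, n ≡ 1 [MOD 2] ∧ v = 9 * n ^ 4}

/-- `Φ₃ = {5}`. -/
def Phi3 : Set ℕ := {5}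

section DifferenceFamily

variable {G : Type*} [AddCommGroup G] [Fintype G] [DecidableEq G]

/-- `B = (B_i)` is a difference family in `G` with parameters `(v; k_i; lam)`: the group has order
`v`, each `B_i` is a `k_i`-subset, and the list of differences `x - y` with `x, y ∈ B_i`, `x ≠ y`,
over all indices `i`, represents each nonzero element of `G` exactly `lam` times. Blocks are
indexed, so repeated blocks are allowed and counted with multiplicity. -/
structure IsDifferenceFamily {ι : Type*} [Fintype ι] (B : ι → Finset G)
    (v : ℕ) (k : ι → ℕ) (lam : ℕ) : Prop where
  card_group : Fintype.card G = v
  card_block : ∀ i, (B i).card = k i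
  card_diff : ∀ g : G, g ≠ 0 →
    ∑ i, ((B i ×ˢ B i).filter fun p => p.1 ≠ p.2 ∧ p.1 - p.2 = g).card = lam

/-- A difference family with `ℓ` blocks, `ℓ ∈ {2, 4, 8}`, is of type `H_ℓ^*` if
`∑ k_i - ℓ (|G| + 1) / 4 = lam` (an identity of rational numbers). -/
def IsTypeHStar (ℓ : ℕ) (B : Fin ℓ → Finset G) : Prop :=
  (ℓ = 2 ∨ ℓ = 4 ∨ ℓ = 8) ∧
    ∃ (k : Fin ℓ → ℕ) (lam : ℕ), IsDifferenceFamily B (Fintype.card G) k lam ∧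
      (∑ i, (k i : ℚ)) - (ℓ : ℚ) * ((Fintype.card G : ℚ) + 1) / 4 = (lam : ℚ)

end DifferenceFamily

/-!
A family of four blocks `B i` in `G` is encoded by the `±1`-valued functions `A i` that are `-1` on
`B i`. It is a difference family of type `H_4^*` exactly when `∑ A i * A i(-·) = 4|G| + 4 - 4J` in
the group ring `ℚ[G]`, where `J` is the sum of all elements (`isTypeHStar_of_gr`).

Let `H` have order `N`, and suppose that `H` carries a *Paley quadruple*: even `±1` functions
`f₀, …, f₃` with `(f₀ + f₁)(f₂ + f₃) = 4J`, `f₀f₁ + f₂f₃ = 2J`, `∑ f_i² = 4N`, and an even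
function `P`, zero at the origin and `±1` elsewhere, with `P² = N - J`. Then with a generator `u` of
`ℤ/5` the elements `1 + P ± (f₀u - f₃u² - f₂u³ + f₁u⁴)` and `1 - P ± (f₂u - f₀u² - f₁u³ + f₃u⁴)`
solve the equation in `ℤ/5 × H` (`IsPaleyQuadruple.exists_isTypeHStar`). It remains to find Paley
quadruples of the orders in `Φ₁` and `Φ₂`.

The constructions live on planes `K × K` over a finite field with `q` elements, where the lines
`L_i` through the origin satisfy `L_i² = q L_i`, `L_i L_j = J` and `∑ L_i = q + J`. If `σ` is a sign
function on the lines with sum `0`, then `P = ∑ σ_i L_i` has `P² = q² - J`. If `q ≡ 1 mod 4`, both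
halves of the lines cut out by `σ` are odd in number, so they carry signed sums `X`, `X'` of lines
with total sign `1`. In both families below the quadruple is `X ± Y`, `X' ± Y'`, where `Y` and
`Y'` are supported, off the origin, on the complementary halves.

* For `q²` with `q ≡ 1 mod 4`, the functions `Y` and `Y'` are the real and imaginary parts of a
  quartic character of the field with `q²` elements, identified with the plane
  (`exists_isPaleyQuadruple_plane`); a Jacobi sum gives `Y² + Y'² = q² - J`.
* For `n⁴` and `9n⁴`, a stronger notion is used, that of a *building quadruple*: `f_i f_j = J` for
  `i ≠ j`, `∑ f_i² = 4N`, and `∏ f_i = -1` off the origin. It yields a Paley quadruple with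
  `P = (f₀ + f₁ - f₂ - f₃)/2`, and building quadruples can be composed
  (`IsBuildingQuadruple.compose`). The complements of the four lines of the plane of order `3`
  give `N = 9`. For `N = p⁴`, `p` an odd prime, `K` has `p²` elements, and `Y`, `Y'` are signed
  sums of *half-lines*, on which the quadratic character of `K` is put. The products of such sums
  are governed by the Paley conference matrix, and what is needed is a pair of vectors with
  complementary supports that the matrix interchanges up to the factor `p`
  (`exists_isBuildingQuadruple_of_paleyConf`). They are half the sum and half the difference of two
  explicit `±1` eigenvectors with eigenvalues `p` and `-p`, which come from a subline
  (`paleyConf_sublineVec`, `paleyConf_twistedSublineVec`).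

The remaining value `v = 5` uses the group of order `25` directly, with the functions
`1 + P`, `1 + P`, `1 - P`, `1 - P` (`exists_isTypeHStar_plane`).
-/

open Finset

/-! ### Group rings and autocorrelation -/

section GroupRing

variable {G : Type*} [Fintype G]

/-- The element `∑ x, f x • [x]` of the group ring `ℚ[G]`. -/
noncomputable def gr (f : G → ℚ) : AddMonoidAlgebra ℚ G :=
  ∑ x, AddMonoidAlgebra.single x (f x)

/-- The sum of all group elements in `ℚ[G]`. -/
noncomputable def grJ (G : Type*) [Fintype G] : AddMonoidAlgebra ℚ G :=
  gr fun _ => 1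

theorem coeff_gr (f : G → ℚ) (x : G) : (gr f).coeff x = f x := by
  classical
  simp [gr, AddMonoidAlgebra.coeff_sum, Finsupp.finsetSum_apply, Finsupp.single_apply]

theorem gr_add (f g : G → ℚ) : gr (fun x => f x + g x) = gr f + gr g := by
  simp [gr, AddMonoidAlgebra.single_add, sum_add_distrib]

theorem gr_sub (f g : G → ℚ) : gr (fun x => f x - g x) = gr f - gr g := by
  simp [gr, AddMonoidAlgebra.single_sub, sum_sub_distrib]

theorem gr_neg (f : G → ℚ) : gr (fun x => -f x) = -gr f := by
  simp [gr, AddMonoidAlgebra.single_neg]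

theorem gr_sum {ι : Type*} (s : Finset ι) (f : ι → G → ℚ) :
    gr (fun x => ∑ i ∈ s, f i x) = ∑ i ∈ s, gr (f i) := by
  classical
  induction s using Finset.induction_on with
  | empty => simp [gr]
  | insert a s ha ih => simp only [sum_insert ha, gr_add, ih]

variable [AddCommGroup G]

theorem gr_const_mul (c : ℚ) (f : G → ℚ) :
    gr (fun x => c * f x) = algebraMap ℚ _ c * gr f := by
  rw [← Algebra.smul_def]
  simp [gr, smul_sum, AddMonoidAlgebra.smul_single]

theorem gr_delta [DecidableEq G] : gr (fun x : G => if x = 0 then 1 else 0) = 1 := by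
  rw [gr, Finset.sum_eq_single 0]
  · simp [AddMonoidAlgebra.one_def]
  · intro b _ hb; simp [hb]
  · simp

theorem gr_mul (f g : G → ℚ) : gr f * gr g = gr fun z => ∑ x, f x * g (z - x) := by
  rw [gr_sum]
  simp only [gr, sum_mul_sum, AddMonoidAlgebra.single_mul_single]
  refine sum_congr rfl fun x _ => ?_
  exact Fintype.sum_equiv (Equiv.addLeft x) _ _ fun y => by simp

theorem gr_mul_grJ (f : G → ℚ) : gr f * grJ G = algebraMap ℚ _ (∑ x, f x) * grJ G := by
  rw [grJ, gr_mul, ← gr_const_mul]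
  simp

/-- The tensor product of two functions is the product of their images in `ℚ[G × H]`. -/
theorem gr_prod {H : Type*} [AddCommGroup H] [Fintype H] (f : G → ℚ) (g : H → ℚ) :
    gr (fun p : G × H => f p.1 * g p.2) =
      AddMonoidAlgebra.mapDomainRingHom ℚ (AddMonoidHom.inl G H) (gr f) *
        AddMonoidAlgebra.mapDomainRingHom ℚ (AddMonoidHom.inr G H) (gr g) := by
  simp only [gr, map_sum, sum_mul, mul_sum, AddMonoidAlgebra.mapDomainRingHom_apply,
    AddMonoidAlgebra.mapDomain_single, AddMonoidAlgebra.single_mul_single, Fintype.sum_prod_type]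
  rw [sum_comm]
  simp

end GroupRing

section Correlation

variable {G : Type*} [AddCommGroup G] [Fintype G] [DecidableEq G]

/-- For a `±1`-valued function, the autocorrelation at `g` counts the pairs with difference `g` in
the block where the function is `-1`. -/
theorem autocorrelation_eq (A : G → ℚ) (hA : ∀ x, A x = 1 ∨ A x = -1) (g : G) (hg : g ≠ 0) :
    ∑ x, A x * A (x - g) = Fintype.card G - 4 * #{x | A x = -1} +
      4 * #((({x | A x = -1} : Finset G) ×ˢ ({x | A x = -1} : Finset G)).filter
        fun p => p.1 ≠ p.2 ∧ p.1 - p.2 = g) := by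
  have hcount : #((({x | A x = -1} : Finset G) ×ˢ ({x | A x = -1} : Finset G)).filter
        fun p => p.1 ≠ p.2 ∧ p.1 - p.2 = g) = #{x | A x = -1 ∧ A (x - g) = -1} := by
    refine card_bij' (fun p _ => p.1) (fun x _ => (x, x - g)) ?_ ?_ ?_ ?_
    · rintro ⟨x, y⟩ h
      simp only [mem_filter, mem_product, mem_univ, true_and] at h ⊢
      obtain ⟨⟨hx, hy⟩, -, rfl⟩ := h
      simpa using ⟨hx, hy⟩
    · intro x h
      simp only [mem_filter, mem_product, mem_univ, true_and] at h ⊢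
      refine ⟨h, ?_, by simp⟩
      intro h'
      exact hg (by simpa using h'.symm)
    · rintro ⟨x, y⟩ h
      simp only [mem_filter, mem_product, mem_univ, true_and] at h ⊢
      obtain ⟨-, -, rfl⟩ := h
      simp
    · simp
  have h1 : ∀ x, A x * A (x - g) = 1 - 2 * (if A x = -1 then 1 else 0) -
      2 * (if A (x - g) = -1 then 1 else 0) +
      4 * (if A x = -1 ∧ A (x - g) = -1 then 1 else 0) := by
    intro x
    rcases hA x with h | h <;> rcases hA (x - g) with h' | h' <;> rw [h, h'] <;> norm_num
  have h2 : ∑ x, (if A (x - g) = -1 then (1 : ℚ) else 0) = ∑ x, if A x = -1 then (1 : ℚ) else 0 :=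
    Fintype.sum_equiv (Equiv.subRight g) _ _ fun x => rfl
  rw [hcount, sum_congr rfl fun x _ => h1 x, sum_add_distrib, sum_sub_distrib, sum_sub_distrib,
    ← mul_sum, ← mul_sum, ← mul_sum, h2]
  simp only [sum_boole, sum_const, card_univ, nsmul_eq_mul]
  ring

/-- Four `±1`-valued functions whose autocorrelations add up to `-4` off the identity give a
difference family of type `H_4^*`. -/
theorem isTypeHStar_of_gr_smul [Nontrivial G] (A : Fin 4 → G → ℚ)
    (hA : ∀ i x, A i x = 1 ∨ A i x = -1)
    (h : ∑ i, gr (A i) * gr (fun x => A i (-x)) =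
      (4 * Fintype.card G + 4 : ℚ) • 1 - (4 : ℚ) • grJ G) :
    IsTypeHStar 4 fun i => ({x | A i x = -1} : Finset G) := by
  have key : ∀ g : G, g ≠ 0 → (∑ i : Fin 4, (#((({x | A i x = -1} : Finset G) ×ˢ
      ({x | A i x = -1} : Finset G)).filter fun p => p.1 ≠ p.2 ∧ p.1 - p.2 = g) : ℚ)) =
      ∑ i : Fin 4, (#({x | A i x = -1} : Finset G) : ℚ) - (Fintype.card G + 1) := by
    intro g hg
    have h1 := congrArg (fun a : AddMonoidAlgebra ℚ G => a.coeff g) h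
    simp only [gr_mul, AddMonoidAlgebra.coeff_sum, Finsupp.finsetSum_apply, coeff_gr, neg_sub,
      AddMonoidAlgebra.coeff_sub, AddMonoidAlgebra.coeff_smul, Finsupp.sub_apply,
      Finsupp.smul_apply, grJ, AddMonoidAlgebra.one_def, AddMonoidAlgebra.coeff_single,
      Finsupp.single_apply, hg.symm, if_false, smul_zero] at h1
    rw [sum_congr rfl fun i _ => autocorrelation_eq (A i) (hA i) g hg] at h1
    simp only [Fin.sum_univ_four, smul_eq_mul] at h1 ⊢
    linarith
  obtain ⟨g₀, hg₀⟩ := exists_ne (0 : G)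
  refine ⟨by simp, fun i => #({x | A i x = -1} : Finset G),
    ∑ i : Fin 4, #((({x | A i x = -1} : Finset G) ×ˢ
      ({x | A i x = -1} : Finset G)).filter fun p => p.1 ≠ p.2 ∧ p.1 - p.2 = g₀),
    ⟨rfl, fun _ => rfl, fun g hg => ?_⟩, ?_⟩
  · have := (key g hg).trans (key g₀ hg₀).symm
    exact_mod_cast this
  · push_cast
    rw [key g₀ hg₀]
    ring

end Correlation

/-! ### Paley quadruples and the group `ℤ/5 × H` -/

section Quadruple

/-- Four even `±1`-valued functions `f i` and an even function `P`, zero exactly at the origin and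
`±1` elsewhere, on a group `H` of order `N`, such that in `ℚ[H]`, with `J` the sum of all elements,
* `(f₀ + f₁)(f₂ + f₃) = 4J` and `f₀f₁ + f₂f₃ = 2J`,
* `f₀² + f₁² + f₂² + f₃² = 4N`,
* `P² = N - J`. -/
structure IsPaleyQuadruple {H : Type*} [AddCommGroup H] [Fintype H]
    (f : Fin 4 → H → ℚ) (P : H → ℚ) : Prop where
  sign : ∀ i x, f i x = 1 ∨ f i x = -1
  even : ∀ i x, f i (-x) = f i x
  paley_zero : P 0 = 0
  paley_sign : ∀ x, x ≠ 0 → P x = 1 ∨ P x = -1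
  paley_even : ∀ x, P (-x) = P x
  cross : (gr (f 0) + gr (f 1)) * (gr (f 2) + gr (f 3)) = 4 * grJ H
  paired : gr (f 0) * gr (f 1) + gr (f 2) * gr (f 3) = 2 * grJ H
  sum_sq : gr (f 0) ^ 2 + gr (f 1) ^ 2 + gr (f 2) ^ 2 + gr (f 3) ^ 2 =
    4 * (Fintype.card H : AddMonoidAlgebra ℚ H)
  paley_sq : gr P ^ 2 = (Fintype.card H : AddMonoidAlgebra ℚ H) - grJ H

theorem isTypeHStar_of_gr {G : Type*} [AddCommGroup G] [Fintype G] [DecidableEq G]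
    [Nontrivial G] (A : Fin 4 → G → ℚ)
    (hA : ∀ i x, A i x = 1 ∨ A i x = -1)
    (h : ∑ i, gr (A i) * gr (fun x => A i (-x)) =
      4 * (Fintype.card G : AddMonoidAlgebra ℚ G) + 4 - 4 * grJ G) :
    IsTypeHStar 4 fun i => ({x | A i x = -1} : Finset G) := by
  refine isTypeHStar_of_gr_smul A hA (h.trans ?_)
  simp only [Algebra.smul_def, map_add, map_mul, map_natCast, map_ofNat, mul_one]

variable {H : Type*} [AddCommGroup H] [Fintype H]

/-- The expansion of an element of `ℚ[ℤ/5 × H]` in powers of a generator of `ℤ/5`. -/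
theorem gr_fin_five (c : Fin 5 → H → ℚ) :
    gr (fun p : Fin 5 × H => c p.1 p.2) =
      (fun (u : AddMonoidAlgebra ℚ (Fin 5 × H))
          (φ : AddMonoidAlgebra ℚ H →+* AddMonoidAlgebra ℚ (Fin 5 × H)) =>
        φ (gr (c 0)) + u * φ (gr (c 1)) + u ^ 2 * φ (gr (c 2)) + u ^ 3 * φ (gr (c 3)) +
          u ^ 4 * φ (gr (c 4)))
      (AddMonoidAlgebra.single (1, 0) 1)
      (AddMonoidAlgebra.mapDomainRingHom ℚ (AddMonoidHom.inr (Fin 5) H)) := by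
  have h1 : (fun p : Fin 5 × H => c p.1 p.2) =
      fun p => ∑ a : Fin 5, (if p.1 = a then 1 else 0) * c a p.2 := by
    funext p; simp
  have h2 : ∀ a : Fin 5, gr (fun p : Fin 5 × H => (if p.1 = a then 1 else 0) * c a p.2) =
      AddMonoidAlgebra.single (a, 0) 1 *
        AddMonoidAlgebra.mapDomainRingHom ℚ (AddMonoidHom.inr (Fin 5) H) (gr (c a)) := by
    intro a
    rw [gr_prod (fun x : Fin 5 => if x = a then 1 else 0) (c a)]
    have h3 : gr (fun x : Fin 5 => if x = a then 1 else 0) = AddMonoidAlgebra.single a 1 := by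
      rw [gr, Finset.sum_eq_single a]
      · simp
      · intro b _ hb; simp [hb]
      · simp
    rw [h3, AddMonoidAlgebra.mapDomainRingHom_apply, AddMonoidAlgebra.mapDomain_single]
    rfl
  have h4 : ∀ n : ℕ, (AddMonoidAlgebra.single ((1 : Fin 5), (0 : H)) (1 : ℚ)) ^ n =
      AddMonoidAlgebra.single (n • (1 : Fin 5), (0 : H)) (1 : ℚ) := by
    intro n
    rw [AddMonoidAlgebra.single_pow]
    simp
  rw [h1, gr_sum, sum_congr rfl fun a _ => h2 a, Fin.sum_univ_five]
  simp only [h4]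
  rw [show AddMonoidAlgebra.single ((0 : Fin 5), (0 : H)) (1 : ℚ) = 1 from rfl, one_mul]
  rfl

/-- With `F₁ = f₀u - f₃u² - f₂u³ + f₁u⁴` and `F₂ = f₂u - f₀u² - f₁u³ + f₃u⁴`, the functions are
`1 + P ± F₁` and `1 - P ± F₂`; their autocorrelations add up to `4 + 4P² + 2F₁F₁* + 2F₂F₂*`, where
`*` inverts `u`. -/
theorem IsPaleyQuadruple.exists_isTypeHStar [DecidableEq H] {f : Fin 4 → H → ℚ} {P : H → ℚ}
    (h : IsPaleyQuadruple f P) :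
    ∃ B : Fin 4 → Finset (Fin 5 × H), IsTypeHStar 4 B := by
  let c : Fin 4 → Fin 5 → H → ℚ :=
    ![![fun x => (if x = 0 then 1 else 0) + P x, f 0, fun x => -f 3 x, fun x => -f 2 x, f 1],
      ![fun x => (if x = 0 then 1 else 0) + P x, fun x => -f 0 x, f 3, f 2, fun x => -f 1 x],
      ![fun x => (if x = 0 then 1 else 0) - P x, f 2, fun x => -f 0 x, fun x => -f 1 x, f 3],
      ![fun x => (if x = 0 then 1 else 0) - P x, fun x => -f 2 x, f 0, f 1, fun x => -f 3 x]]
  have hP1 : ∀ x, (if x = 0 then 1 else 0) + P x = 1 ∨ (if x = 0 then 1 else 0) + P x = -1 := by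
    intro x
    by_cases hx : x = 0
    · simp [hx, h.paley_zero]
    · simpa [hx] using h.paley_sign x hx
  have hP2 : ∀ x, (if x = 0 then 1 else 0) - P x = 1 ∨ (if x = 0 then 1 else 0) - P x = -1 := by
    intro x
    by_cases hx : x = 0
    · simp [hx, h.paley_zero]
    · rcases h.paley_sign x hx with h | h <;> simp [hx, h]
  have hneg : ∀ i x, -f i x = 1 ∨ -f i x = -1 := by
    intro i x
    rcases h.sign i x with h | h <;> simp [h]
  have hc : ∀ i a x, c i a x = 1 ∨ c i a x = -1 := by
    intro i a x
    fin_cases i <;> fin_cases a <;>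
      first
        | exact hP1 x
        | exact hP2 x
        | exact h.sign _ x
        | exact hneg _ x
  have hce : ∀ i a x, c i a (-x) = c i a x := by
    intro i a x
    fin_cases i <;> fin_cases a <;> simp [c, h.even, h.paley_even]
  have : Nontrivial (Fin 5 × H) := by
    have : Nontrivial (Fin 5) := ⟨0, 1, by decide⟩
    infer_instance
  refine ⟨_, isTypeHStar_of_gr (fun i (p : Fin 5 × H) => c i p.1 p.2) (fun i p => hc _ _ _) ?_⟩
  have hrev : ∀ i, (fun p : Fin 5 × H => c i (-p).1 (-p).2) =
      fun p : Fin 5 × H => (fun a : Fin 5 => c i (-a)) p.1 p.2 := by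
    intro i; funext p; exact hce _ _ _
  have hJ : grJ (Fin 5 × H) = gr fun p : Fin 5 × H => (fun _ _ => 1 : Fin 5 → H → ℚ) p.1 p.2 :=
    rfl
  rw [hJ, gr_fin_five fun _ _ => 1]
  simp_rw [hrev, fun i => gr_fin_five (c i), fun i => gr_fin_five fun a => c i (-a)]
  set u := AddMonoidAlgebra.single ((1 : Fin 5), (0 : H)) (1 : ℚ) with hu
  have hu5 : u ^ 5 = 1 := by
    rw [hu, AddMonoidAlgebra.single_pow, AddMonoidAlgebra.one_def]
    have : (5 : ℕ) • ((1 : Fin 5), (0 : H)) = 0 := by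
      ext
      · rfl
      · simp
    rw [this]; simp
  set φ := AddMonoidAlgebra.mapDomainRingHom ℚ (AddMonoidHom.inr (Fin 5) H)
  have e1 := congrArg φ h.cross
  have e2 := congrArg φ h.paired
  have e3 := congrArg φ h.sum_sq
  have e4 := congrArg φ h.paley_sq
  simp only [map_add, map_mul, map_sub, map_pow, map_natCast, map_ofNat] at e1 e2 e3 e4
  have hcard : (Fintype.card (Fin 5 × H) : AddMonoidAlgebra ℚ (Fin 5 × H)) =
      5 * (Fintype.card H : AddMonoidAlgebra ℚ (Fin 5 × H)) := by
    rw [Fintype.card_prod, Fintype.card_fin]; push_cast; rfl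
  rw [hcard, show gr (fun _ : H => (1 : ℚ)) = grJ H from rfl]
  simp only [Fin.sum_univ_four]
  simp only [show -(0 : Fin 5) = 0 from rfl, show -(1 : Fin 5) = 4 from rfl,
    show -(2 : Fin 5) = 3 from rfl, show -(3 : Fin 5) = 2 from rfl,
    show -(4 : Fin 5) = 1 from rfl]
  simp [c, gr_add, gr_neg, gr_sub, gr_delta]
  generalize (Fintype.card H : AddMonoidAlgebra ℚ (Fin 5 × H)) = N at *
  generalize φ (grJ H) = J at *
  generalize φ (gr (f 0)) = f0 at *
  generalize φ (gr (f 1)) = f1 at *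
  generalize φ (gr (f 2)) = f2 at *
  generalize φ (gr (f 3)) = f3 at *
  generalize φ (gr P) = p at *
  -- Once the coefficients are compared, what remains is the reduction of the exponents modulo `5`.
  linear_combination 4 * e4 + 4 * e3 + 2 * (u + u ^ 2 + u ^ 3 + u ^ 4) * e2 -
    2 * (u + u ^ 2 + u ^ 3 + u ^ 4) * e1 +
    2 * (2 * (f0 ^ 2 + f1 ^ 2 + f2 ^ 2 + f3 ^ 2) +
      u * (-f0 * f3 + f3 * f2 - f1 * f2 - f0 * f2 + f0 * f1 - f1 * f3) +
      u ^ 2 * (-f2 * f0 - f1 * f3 - f1 * f2 - f0 * f3) + u ^ 3 * (f0 * f1 + f2 * f3)) * hu5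

end Quadruple

/-! ### Building quadruples and their composition -/

section Building

/-- A covering building quadruple on a group `H` of order `N`: four even `±1`-valued functions with
`f_i f_j = J` for `i ≠ j` and `∑ f_i² = 4N` in `ℚ[H]` (equivalently, each nontrivial character is
nonzero on exactly one `f_i`, with value `±2√N`), whose pointwise product is `1` at the origin and
`-1` elsewhere. -/
structure IsBuildingQuadruple {H : Type*} [AddCommGroup H] [Fintype H]
    (f : Fin 4 → H → ℚ) : Prop where
  sign : ∀ i x, f i x = 1 ∨ f i x = -1
  even : ∀ i x, f i (-x) = f i x
  prod_zero : ∏ i, f i 0 = 1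
  prod_ne_zero : ∀ x, x ≠ 0 → ∏ i, f i x = -1
  mul : ∀ i j, i ≠ j → gr (f i) * gr (f j) = grJ H
  sum_sq : ∑ i, gr (f i) ^ 2 = 4 * (Fintype.card H : AddMonoidAlgebra ℚ H)

variable {H : Type*} [AddCommGroup H] [Fintype H]

theorem IsBuildingQuadruple.comp_perm {f : Fin 4 → H → ℚ} (h : IsBuildingQuadruple f)
    (σ : Equiv.Perm (Fin 4)) : IsBuildingQuadruple fun i => f (σ i) where
  sign _ x := h.sign _ x
  even _ x := h.even _ x
  prod_zero := (Equiv.prod_comp σ fun i => f i 0).trans h.prod_zero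
  prod_ne_zero x hx := (Equiv.prod_comp σ fun i => f i x).trans (h.prod_ne_zero x hx)
  mul _ _ hij := h.mul _ _ (σ.injective.ne hij)
  sum_sq := (Equiv.sum_comp σ fun i => gr (f i) ^ 2).trans h.sum_sq

/-- The image of `1/2` in a group ring, together with its defining property, lets `ring` treat
halves. -/
theorem two_mul_algebraMap_half (G : Type*) [AddCommGroup G] :
    2 * algebraMap ℚ (AddMonoidAlgebra ℚ G) (1 / 2) = 1 := by
  rw [← map_ofNat (algebraMap ℚ (AddMonoidAlgebra ℚ G)) 2, ← map_mul,
    show (2 : ℚ) * (1 / 2) = 1 by norm_num, map_one]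

theorem IsBuildingQuadruple.isPaleyQuadruple {f : Fin 4 → H → ℚ} (h : IsBuildingQuadruple f)
    (h0 : f 0 0 + f 1 0 = f 2 0 + f 3 0) :
    IsPaleyQuadruple f fun x => 1 / 2 * (f 0 x + f 1 x - f 2 x - f 3 x) where
  sign := h.sign
  even := h.even
  paley_zero := by linarith
  paley_sign x hx := by
    have hp := h.prod_ne_zero x hx
    rw [Fin.prod_univ_four] at hp
    rcases h.sign 0 x with a | a <;> rcases h.sign 1 x with b | b <;>
      rcases h.sign 2 x with c | c <;> rcases h.sign 3 x with d | d <;>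
      rw [a, b, c, d] at hp ⊢ <;> norm_num at hp <;> norm_num
  paley_even x := by simp only [h.even]
  cross := by
    linear_combination h.mul 0 2 (by decide) + h.mul 0 3 (by decide) + h.mul 1 2 (by decide) +
      h.mul 1 3 (by decide)
  paired := by
    linear_combination h.mul 0 1 (by decide) + h.mul 2 3 (by decide)
  sum_sq := by
    rw [← h.sum_sq, Fin.sum_univ_four]
  paley_sq := by
    have ht := two_mul_algebraMap_half H
    have hs := h.sum_sq
    rw [Fin.sum_univ_four] at hs
    rw [gr_const_mul, gr_sub, gr_sub, gr_add]
    set t := algebraMap ℚ (AddMonoidAlgebra ℚ H) (1 / 2)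
    linear_combination t ^ 2 * hs + 2 * t ^ 2 * h.mul 0 1 (by decide) +
      2 * t ^ 2 * h.mul 2 3 (by decide) - 2 * t ^ 2 * h.mul 0 2 (by decide) -
      2 * t ^ 2 * h.mul 0 3 (by decide) - 2 * t ^ 2 * h.mul 1 2 (by decide) -
      2 * t ^ 2 * h.mul 1 3 (by decide) +
      (2 * t + 1) * ((Fintype.card H : AddMonoidAlgebra ℚ H) - grJ H) * ht

/-- At the origin the four values are all equal or split two against two, so after a permutation
`f₀ + f₁ = f₂ + f₃` there. -/
theorem IsBuildingQuadruple.exists_isPaleyQuadruple {f : Fin 4 → H → ℚ}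
    (h : IsBuildingQuadruple f) : ∃ (g : Fin 4 → H → ℚ) (P : H → ℚ), IsPaleyQuadruple g P := by
  have hp := h.prod_zero
  rw [Fin.prod_univ_four] at hp
  by_cases h0 : f 0 0 + f 1 0 = f 2 0 + f 3 0
  · exact ⟨_, _, h.isPaleyQuadruple h0⟩
  · refine ⟨_, _, (h.comp_perm (Equiv.swap 1 2)).isPaleyQuadruple ?_⟩
    have e0 : Equiv.swap (1 : Fin 4) 2 0 = 0 := by decide
    have e3 : Equiv.swap (1 : Fin 4) 2 3 = 3 := by decide
    simp only [Equiv.swap_apply_left, Equiv.swap_apply_right, e0, e3]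
    rcases h.sign 0 0 with a | a <;> rcases h.sign 1 0 with b | b <;>
      rcases h.sign 2 0 with c | c <;> rcases h.sign 3 0 with d | d <;>
      rw [a, b, c, d] at hp h0 <;> norm_num at hp <;> norm_num at h0 <;> linarith

theorem isBuildingQuadruple_one : IsBuildingQuadruple fun (_ : Fin 4) (_ : Unit) => (1 : ℚ) where
  sign := by simp
  even := by simp
  prod_zero := by simp
  prod_ne_zero x hx := (hx (Subsingleton.elim _ _)).elim
  mul i j _ := by
    rw [show gr (fun _ : Unit => (1 : ℚ)) = grJ Unit from rfl]
    change gr (fun _ : Unit => (1 : ℚ)) * grJ Unit = _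
    rw [gr_mul_grJ, show ∑ _ : Unit, (1 : ℚ) = 1 by simp, map_one, one_mul]
  sum_sq := by
    have : gr (fun _ : Unit => (1 : ℚ)) = 1 := by
      simp [gr, AddMonoidAlgebra.one_def]
    simp [this]

/-- The composition of two building quadruples `f` on `H` and `g` on `K`: the four functions
`½((f₀ + f₁)g₀ + (f₀ - f₁)g₁)`, `½((f₀ + f₁)g₂ - (f₀ - f₁)g₃)`, `½((f₂ - f₃)g₀ + (f₂ + f₃)g₁)`,
`½((f₂ + f₃)g₃ - (f₂ - f₃)g₂)` on `H × K`. -/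
def composeQuadruple {K : Type*} (f : Fin 4 → H → ℚ) (g : Fin 4 → K → ℚ) :
    Fin 4 → H × K → ℚ :=
  ![fun p => 1 / 2 * ((f 0 p.1 + f 1 p.1) * g 0 p.2 + (f 0 p.1 - f 1 p.1) * g 1 p.2),
    fun p => 1 / 2 * ((f 0 p.1 + f 1 p.1) * g 2 p.2 - (f 0 p.1 - f 1 p.1) * g 3 p.2),
    fun p => 1 / 2 * ((f 2 p.1 - f 3 p.1) * g 0 p.2 + (f 2 p.1 + f 3 p.1) * g 1 p.2),
    fun p => 1 / 2 * ((f 2 p.1 + f 3 p.1) * g 3 p.2 - (f 2 p.1 - f 3 p.1) * g 2 p.2)]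

theorem IsBuildingQuadruple.compose {K : Type*} [AddCommGroup K] [Fintype K]
    {f : Fin 4 → H → ℚ} {g : Fin 4 → K → ℚ} (hf : IsBuildingQuadruple f)
    (hg : IsBuildingQuadruple g) : IsBuildingQuadruple (composeQuadruple f g) := by
  let φ := AddMonoidAlgebra.mapDomainRingHom ℚ (AddMonoidHom.inl H K)
  let ψ := AddMonoidAlgebra.mapDomainRingHom ℚ (AddMonoidHom.inr H K)
  have hsgn : ∀ a b c d : ℚ, (a = 1 ∨ a = -1) → (b = 1 ∨ b = -1) → (c = 1 ∨ c = -1) →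
      (d = 1 ∨ d = -1) → 1 / 2 * ((a + b) * c + (a - b) * d) = 1 ∨
        1 / 2 * ((a + b) * c + (a - b) * d) = -1 := by
    rintro a b c d (rfl | rfl) (rfl | rfl) (rfl | rfl) (rfl | rfl) <;> norm_num
  have hn : ∀ a : ℚ, (a = 1 ∨ a = -1) → (-a = 1 ∨ -a = -1) := by
    rintro a (rfl | rfl) <;> norm_num
  have F01 := congrArg φ (hf.mul 0 1 (by decide))
  have F02 := congrArg φ (hf.mul 0 2 (by decide))
  have F03 := congrArg φ (hf.mul 0 3 (by decide))
  have F12 := congrArg φ (hf.mul 1 2 (by decide))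
  have F13 := congrArg φ (hf.mul 1 3 (by decide))
  have F23 := congrArg φ (hf.mul 2 3 (by decide))
  have FS := congrArg φ hf.sum_sq
  have G01 := congrArg ψ (hg.mul 0 1 (by decide))
  have G02 := congrArg ψ (hg.mul 0 2 (by decide))
  have G03 := congrArg ψ (hg.mul 0 3 (by decide))
  have G12 := congrArg ψ (hg.mul 1 2 (by decide))
  have G13 := congrArg ψ (hg.mul 1 3 (by decide))
  have G23 := congrArg ψ (hg.mul 2 3 (by decide))
  have GS := congrArg ψ hg.sum_sq
  simp only [map_mul, map_pow, map_natCast, map_ofNat, Fin.sum_univ_four, map_add]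
    at F01 F02 F03 F12 F13 F23 FS G01 G02 G03 G12 G13 G23 GS
  have hJ : grJ (H × K) = φ (grJ H) * ψ (grJ K) := by
    rw [grJ, grJ, grJ, ← gr_prod]
    simp
  have ht := two_mul_algebraMap_half (H × K)
  set t := algebraMap ℚ (AddMonoidAlgebra ℚ (H × K)) (1 / 2)
  have hadd : ∀ (a c : H → ℚ) (b d : K → ℚ),
      gr (fun p : H × K => 1 / 2 * (a p.1 * b p.2 + c p.1 * d p.2)) =
        t * (φ (gr a) * ψ (gr b) + φ (gr c) * ψ (gr d)) := by
    intro a c b d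
    rw [gr_const_mul, gr_add (fun p : H × K => a p.1 * b p.2) fun p => c p.1 * d p.2,
      gr_prod, gr_prod]
  have hsub : ∀ (a c : H → ℚ) (b d : K → ℚ),
      gr (fun p : H × K => 1 / 2 * (a p.1 * b p.2 - c p.1 * d p.2)) =
        t * (φ (gr a) * ψ (gr b) - φ (gr c) * ψ (gr d)) := by
    intro a c b d
    rw [gr_const_mul, gr_sub (fun p : H × K => a p.1 * b p.2) fun p => c p.1 * d p.2,
      gr_prod, gr_prod]
  have E0 := hadd (fun x => f 0 x + f 1 x) (fun x => f 0 x - f 1 x) (g 0) (g 1)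
  have E1 := hsub (fun x => f 0 x + f 1 x) (fun x => f 0 x - f 1 x) (g 2) (g 3)
  have E2 := hadd (fun x => f 2 x - f 3 x) (fun x => f 2 x + f 3 x) (g 0) (g 1)
  have E3 := hsub (fun x => f 2 x + f 3 x) (fun x => f 2 x - f 3 x) (g 3) (g 2)
  rw [gr_add, gr_sub, map_add, map_sub] at E0 E1 E2 E3
  let F : Fin 4 → AddMonoidAlgebra ℚ (H × K) := fun i => φ (gr (f i))
  let G : Fin 4 → AddMonoidAlgebra ℚ (H × K) := fun i => ψ (gr (g i))
  change F 0 * F 1 = _ at F01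
  change F 0 * F 2 = _ at F02
  change F 0 * F 3 = _ at F03
  change F 1 * F 2 = _ at F12
  change F 1 * F 3 = _ at F13
  change F 2 * F 3 = _ at F23
  change F 0 ^ 2 + F 1 ^ 2 + F 2 ^ 2 + F 3 ^ 2 = _ at FS
  change G 0 * G 1 = _ at G01
  change G 0 * G 2 = _ at G02
  change G 0 * G 3 = _ at G03
  change G 1 * G 2 = _ at G12
  change G 1 * G 3 = _ at G13
  change G 2 * G 3 = _ at G23
  change G 0 ^ 2 + G 1 ^ 2 + G 2 ^ 2 + G 3 ^ 2 = _ at GS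
  change _ = t * ((F 0 + F 1) * G 0 + (F 0 - F 1) * G 1) at E0
  change _ = t * ((F 0 + F 1) * G 2 - (F 0 - F 1) * G 3) at E1
  change _ = t * ((F 2 - F 3) * G 0 + (F 2 + F 3) * G 1) at E2
  change _ = t * ((F 2 + F 3) * G 3 - (F 2 - F 3) * G 2) at E3
  -- If `f` has product `1` at a point, its signs agree or split two against two, and the values of
  -- the composition are those of `g` up to order and an even number of signs; otherwise `g` enters
  -- only through squares.
  have hprod : ∀ p, ∏ i, composeQuadruple f g i p =
      if ∏ i, f i p.1 = 1 then ∏ i, g i p.2 else -1 := by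
    intro p
    simp only [Fin.prod_univ_four, composeQuadruple]
    simp only [Matrix.cons_val]
    have hsq : ∀ i j, (g i p.2 * g j p.2) ^ 2 = 1 := by
      intro i j
      rcases hg.sign i p.2 with a | a <;> rcases hg.sign j p.2 with b | b <;> rw [a, b] <;> norm_num
    rcases hf.sign 0 p.1 with a | a <;> rcases hf.sign 1 p.1 with b | b <;>
      rcases hf.sign 2 p.1 with c | c <;> rcases hf.sign 3 p.1 with d | d <;>
      rw [a, b, c, d] <;> norm_num <;>
      first
        | ring1
        | linear_combination hsq 0 2
        | linear_combination hsq 1 3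
  refine ⟨?_, ?_, ?_, ?_, ?_, ?_⟩
  · intro i p
    fin_cases i
    · exact hsgn _ _ _ _ (hf.sign 0 _) (hf.sign 1 _) (hg.sign 0 _) (hg.sign 1 _)
    · have := hsgn _ _ _ _ (hf.sign 0 p.1) (hf.sign 1 p.1) (hg.sign 2 p.2) (hn _ (hg.sign 3 p.2))
      rwa [mul_neg, ← sub_eq_add_neg] at this
    · have := hsgn _ _ _ _ (hf.sign 2 p.1) (hf.sign 3 p.1) (hg.sign 1 p.2) (hg.sign 0 p.2)
      rwa [add_comm] at this
    · have := hsgn _ _ _ _ (hf.sign 2 p.1) (hf.sign 3 p.1) (hg.sign 3 p.2) (hn _ (hg.sign 2 p.2))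
      rwa [mul_neg, ← sub_eq_add_neg] at this
  · intro i p
    fin_cases i <;> simp [composeQuadruple, hf.even, hg.even]
  · rw [hprod]; simp [hf.prod_zero, hg.prod_zero]
  · rintro ⟨x, y⟩ hxy
    rw [hprod]
    by_cases hx : x = 0
    · have hy : y ≠ 0 := by rintro rfl; exact hxy (by simp [hx])
      simp [hx, hf.prod_zero, hg.prod_ne_zero y hy]
    · rw [if_neg]
      rw [hf.prod_ne_zero x hx]; norm_num
  · have key : ∀ i j : Fin 4, i < j → gr (composeQuadruple f g i) * gr (composeQuadruple f g j) =
        grJ (H × K) := by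
      intro i j hij
      rw [hJ]
      fin_cases i <;> fin_cases j <;> first | exact absurd hij (by decide) | skip
      · refine (congrArg₂ _ E0 E1).trans ?_
        linear_combination t ^ 2 * ((F 0 + F 1) ^ 2 * G02 - (F 0 + F 1) * (F 0 - F 1) * G03 +
          (F 0 + F 1) * (F 0 - F 1) * G12 - (F 0 - F 1) ^ 2 * G13 + 4 * ψ (grJ K) * F01) +
          (2 * t + 1) * (φ (grJ H) * ψ (grJ K)) * ht
      · refine (congrArg₂ _ E0 E2).trans ?_
        linear_combination t ^ 2 * (G 0 ^ 2 * (F02 - F03 + F12 - F13) + G 0 * G 1 * ((F02 + F03 +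
          F12 + F13) + (F02 - F03 - F12 + F13)) + G 1 ^ 2 * (F02 + F03 - F12 - F13) +
            4 * φ (grJ H) * G01) +
          (2 * t + 1) * (φ (grJ H) * ψ (grJ K)) * ht
      · refine (congrArg₂ _ E0 E3).trans ?_
        linear_combination t ^ 2 * (G 0 * G 3 * (F02 + F03 + F12 + F13) - G 0 * G 2 * (F02 -
          F03 + F12 - F13) + G 1 * G 3 * (F02 + F03 - F12 - F13) - G 1 * G 2 * (F02 - F03 - F12 +
            F13) + 4 * φ (grJ H) * G03) +
          (2 * t + 1) * (φ (grJ H) * ψ (grJ K)) * ht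
      · refine (congrArg₂ _ E1 E2).trans ?_
        linear_combination t ^ 2 * (G 0 * G 2 * (F02 - F03 + F12 - F13) + G 1 * G 2 * (F02 +
          F03 + F12 + F13) - G 0 * G 3 * (F02 - F03 - F12 + F13) - G 1 * G 3 * (F02 + F03 - F12 -
            F13) + 4 * φ (grJ H) * G12) +
          (2 * t + 1) * (φ (grJ H) * ψ (grJ K)) * ht
      · refine (congrArg₂ _ E1 E3).trans ?_
        linear_combination t ^ 2 * (G 2 * G 3 * (F02 + F03 + F12 + F13) - G 2 ^ 2 * (F02 - F03 +
          F12 - F13) - G 3 ^ 2 * (F02 + F03 - F12 - F13) + G 2 * G 3 * (F02 - F03 - F12 + F13) +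
            4 * φ (grJ H) * G23) +
          (2 * t + 1) * (φ (grJ H) * ψ (grJ K)) * ht
      · refine (congrArg₂ _ E2 E3).trans ?_
        linear_combination t ^ 2 * ((F 2 + F 3) * (F 2 - F 3) * G03 - (F 2 - F 3) ^ 2 * G02 +
          (F 2 + F 3) ^ 2 * G13 - (F 2 + F 3) * (F 2 - F 3) * G12 + 4 * ψ (grJ K) * F23) +
          (2 * t + 1) * (φ (grJ H) * ψ (grJ K)) * ht
    intro i j hij
    rcases lt_or_gt_of_ne hij with h | h
    · exact key i j h
    · rw [mul_comm]; exact key j i h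
  · rw [Fin.sum_univ_four, Fintype.card_prod]
    refine (congrArg₂ _ (congrArg₂ _ (congrArg₂ _ (congrArg (· ^ 2) E0) (congrArg (· ^ 2) E1))
      (congrArg (· ^ 2) E2)) (congrArg (· ^ 2) E3)).trans ?_
    push_cast
    linear_combination t ^ 2 * ((G 0 ^ 2 + G 2 ^ 2) * (2 * F01 - 2 * F23) +
      (G 1 ^ 2 + G 3 ^ 2) * (-2 * F01 + 2 * F23) +
      (2 * (F 0 + F 1) * (F 0 - F 1) + 2 * (F 2 + F 3) * (F 2 - F 3)) * (G01 - G23) +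
      (G 0 ^ 2 + G 1 ^ 2 + G 2 ^ 2 + G 3 ^ 2) * FS +
        4 * (Fintype.card H : AddMonoidAlgebra ℚ (H × K)) * GS) +
      4 * (Fintype.card H : AddMonoidAlgebra ℚ (H × K)) *
        (Fintype.card K : AddMonoidAlgebra ℚ (H × K)) * (2 * t + 1) * ht

end Building

/-! ### Lines of the affine plane -/

section Spread

variable {K : Type*} [Field K]

/-- Representatives of the points of the projective line over `K`: `none` is the point at infinity
`(1, 0)`, and `some a` is the affine point `(a, 1)`. -/
def projPt : Option K → K × K
  | none => (1, 0)
  | some a => (a, 1)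

/-- The determinant of two vectors of `K × K`. -/
def planeDet (x y : K × K) : K := x.1 * y.2 - x.2 * y.1

theorem planeDet_swap (x y : K × K) : planeDet y x = -planeDet x y := by
  simp [planeDet]; ring

theorem planeDet_projPt_ne_zero {i j : Option K} (h : i ≠ j) :
    planeDet (projPt i) (projPt j) ≠ 0 := by
  rcases i with _ | a <;> rcases j with _ | b
  · exact (h rfl).elim
  · simp [planeDet, projPt]
  · simp [planeDet, projPt]
  · have : a ≠ b := fun hab => h (by rw [hab])
    simpa [planeDet, projPt, sub_eq_zero] using this

theorem exists_smul_projPt_eq (z : K × K) (hz : z ≠ 0) :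
    ∃ (i : Option K) (c : K), c ≠ 0 ∧ z = c • projPt i := by
  rcases z with ⟨x, y⟩
  by_cases hy : y = 0
  · refine ⟨none, x, ?_, by simp [projPt, hy]⟩
    rintro rfl
    exact hz (by simp [hy])
  · exact ⟨some (x / y), y, hy, by simp [projPt, mul_div_cancel₀, hy]⟩

/-- The map `ℚ[K] → ℚ[K × K]` induced by the embedding of `K` as the line through `projPt i`. -/
noncomputable def lineHom (i : Option K) :
    AddMonoidAlgebra ℚ K →+* AddMonoidAlgebra ℚ (K × K) :=
  AddMonoidAlgebra.mapDomainRingHom ℚ (((LinearMap.id : K →ₗ[K] K).smulRight (projPt i)) :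
    K →+ K × K)

theorem lineHom_gr [Fintype K] (i : Option K) (φ : K → ℚ) :
    lineHom i (gr φ) = ∑ c, AddMonoidAlgebra.single (c • projPt i) (φ c) := by
  simp [lineHom, gr]

variable [DecidableEq K]

/-- The function on `K × K` supported on the line through `projPt i`, with value `φ c` at
`c • projPt i`. -/
def onLine (φ : K → ℚ) : Option K → K × K → ℚ
  | none => fun z => if z.2 = 0 then φ z.1 else 0
  | some a => fun z => if z.1 = a * z.2 then φ z.2 else 0

theorem onLine_zero (φ : K → ℚ) (i : Option K) : onLine φ i 0 = φ 0 := by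
  cases i <;> simp [onLine]

theorem onLine_smul_projPt (φ : K → ℚ) (i j : Option K) {c : K} (hc : c ≠ 0) :
    onLine φ j (c • projPt i) = if j = i then φ c else 0 := by
  rcases i with _ | a <;> rcases j with _ | b
  · simp [onLine, projPt]
  · simp [onLine, projPt, hc]
  · simp [onLine, projPt, hc]
  · simp only [onLine, projPt, Prod.smul_mk, smul_eq_mul, mul_one, Option.some.injEq]
    refine if_congr ?_ rfl rfl
    rw [mul_comm b, mul_right_inj' hc, eq_comm]

theorem onLine_neg {φ : K → ℚ} (hφ : ∀ c, φ (-c) = φ c) (i : Option K) (z : K × K) :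
    onLine φ i (-z) = onLine φ i z := by
  cases i <;> simp [onLine, hφ]

theorem onLine_one_eq (i : Option K) (z : K × K) :
    onLine (fun _ => 1) i z = if planeDet z (projPt i) = 0 then 1 else 0 := by
  rcases i with _ | a
  · simp [onLine, planeDet, projPt]
  · simp only [onLine, planeDet, projPt, mul_one, sub_eq_zero]
    rw [mul_comm]

variable [Fintype K]

/-- The combination `∑ i, a i • onLine φ i` over all lines through the origin. -/
def lineSum (a : Option K → ℚ) (φ : K → ℚ) (z : K × K) : ℚ := ∑ i, a i * onLine φ i z

theorem lineSum_zero (a : Option K → ℚ) (φ : K → ℚ) : lineSum a φ 0 = (∑ i, a i) * φ 0 := by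
  simp only [lineSum, onLine_zero, sum_mul]

theorem lineSum_smul_projPt (a : Option K → ℚ) (φ : K → ℚ) (i : Option K) {c : K} (hc : c ≠ 0) :
    lineSum a φ (c • projPt i) = a i * φ c := by
  simp [lineSum, onLine_smul_projPt _ _ _ hc]

theorem lineSum_neg (a : Option K → ℚ) {φ : K → ℚ} (hφ : ∀ c, φ (-c) = φ c) (z : K × K) :
    lineSum a φ (-z) = lineSum a φ z := by
  simp [lineSum, onLine_neg hφ]

theorem gr_lineSum (a : Option K → ℚ) (φ : K → ℚ) :
    gr (lineSum a φ) = ∑ i, algebraMap ℚ _ (a i) * gr (onLine φ i) := by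
  unfold lineSum
  rw [gr_sum]
  exact sum_congr rfl fun i _ => gr_const_mul _ _

theorem gr_onLine (φ : K → ℚ) (i : Option K) : gr (onLine φ i) = lineHom i (gr φ) := by
  rw [lineHom_gr, gr, Fintype.sum_prod_type]
  rcases i with _ | a
  · refine sum_congr rfl fun c _ => ?_
    rw [Finset.sum_eq_single 0]
    · simp [onLine, projPt]
    · intro b _ hb; simp [onLine, hb]
    · simp
  · rw [sum_comm]
    refine sum_congr rfl fun c _ => ?_
    rw [Finset.sum_eq_single (a * c)]
    · simp [onLine, projPt, mul_comm]
    · intro b _ hb; simp [onLine, hb]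
    · simp

/-- Distinct lines span the plane, so the product of functions on them is a function of the two
coordinates. -/
theorem gr_onLine_mul_of_ne (φ ψ : K → ℚ) {i j : Option K} (h : i ≠ j) :
    gr (onLine φ i) * gr (onLine ψ j) = gr fun z =>
      φ (planeDet z (projPt j) / planeDet (projPt i) (projPt j)) *
        ψ (planeDet (projPt i) z / planeDet (projPt i) (projPt j)) := by
  have hD := planeDet_projPt_ne_zero h
  have h1 : ∀ p : K × K, planeDet (p.1 • projPt i + p.2 • projPt j) (projPt j) /
      planeDet (projPt i) (projPt j) = p.1 := by
    intro p
    rw [div_eq_iff hD]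
    simp [planeDet]; ring
  have h2 : ∀ p : K × K, planeDet (projPt i) (p.1 • projPt i + p.2 • projPt j) /
      planeDet (projPt i) (projPt j) = p.2 := by
    intro p
    rw [div_eq_iff hD]
    simp [planeDet]; ring
  have hb : Function.Bijective fun p : K × K => p.1 • projPt i + p.2 • projPt j := by
    refine Finite.injective_iff_bijective.mp fun p p' hp => ?_
    have hp' : p.1 • projPt i + p.2 • projPt j = p'.1 • projPt i + p'.2 • projPt j := hp
    ext
    · rw [← h1 p, ← h1 p', hp']
    · rw [← h2 p, ← h2 p', hp']
  rw [gr_onLine, gr_onLine, lineHom_gr, lineHom_gr, sum_mul_sum, ← Fintype.sum_prod_type', gr]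
  refine Fintype.sum_bijective _ hb _ _ fun p => ?_
  rw [h1, h2, AddMonoidAlgebra.single_mul_single]

/-- The sum of the elements of the line through `projPt i`. -/
noncomputable def lineElem (i : Option K) : AddMonoidAlgebra ℚ (K × K) :=
  gr (onLine (fun _ => 1) i)

theorem lineElem_sq (i : Option K) :
    lineElem i * lineElem i = (Fintype.card K : AddMonoidAlgebra ℚ (K × K)) * lineElem i := by
  have h := gr_mul_grJ fun _ : K => (1 : ℚ)
  rw [lineElem, gr_onLine, ← map_mul]
  conv_lhs => rw [show gr (fun _ : K => (1 : ℚ)) * gr (fun _ : K => (1 : ℚ)) = _ from h]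
  simp [grJ]

theorem lineElem_mul_of_ne {i j : Option K} (h : i ≠ j) :
    lineElem i * lineElem j = grJ (K × K) := by
  rw [lineElem, lineElem, gr_onLine_mul_of_ne _ _ h, grJ]
  simp

theorem sum_lineElem : ∑ i : Option K, lineElem i =
    (Fintype.card K : AddMonoidAlgebra ℚ (K × K)) + grJ (K × K) := by
  have h1 : ∑ i : Option K, lineElem i = gr (lineSum (fun _ => 1) fun _ : K => 1) := by
    rw [gr_lineSum]; simp only [lineElem, map_one, one_mul]
  have h2 : lineSum (fun _ => 1) (fun _ : K => 1) = fun z =>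
      (Fintype.card K : ℚ) * (if z = 0 then 1 else 0) + 1 := by
    funext z
    by_cases hz : z = 0
    · subst hz
      rw [lineSum_zero]; simp
    · obtain ⟨i, c, hc, rfl⟩ := exists_smul_projPt_eq z hz
      rw [lineSum_smul_projPt _ _ _ hc]
      simp only [if_neg hz]; norm_num
  rw [h1, h2, gr_add (fun z => (Fintype.card K : ℚ) * (if z = 0 then 1 else 0)) fun _ => 1,
    gr_const_mul, gr_delta, grJ]
  simp

/-- The product of two combinations of lines. -/
theorem gr_lineSum_mul_lineSum (a b : Option K → ℚ) :
    gr (lineSum a fun _ => 1) * gr (lineSum b fun _ => 1) =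
      (Fintype.card K : AddMonoidAlgebra ℚ (K × K)) *
        (∑ i, algebraMap ℚ _ (a i * b i) * lineElem i) +
      algebraMap ℚ _ ((∑ i, a i) * (∑ i, b i) - ∑ i, a i * b i) * grJ (K × K) := by
  have h1 : ∀ i j, lineElem i * lineElem j = grJ (K × K) + if i = j then
      (Fintype.card K : AddMonoidAlgebra ℚ (K × K)) * lineElem i - grJ (K × K) else 0 := by
    intro i j
    by_cases h : i = j
    · subst h; rw [lineElem_sq]; simp
    · rw [lineElem_mul_of_ne h, if_neg h, add_zero]
  rw [gr_lineSum, gr_lineSum, sum_mul_sum]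
  have h2 : ∀ i j, algebraMap ℚ (AddMonoidAlgebra ℚ (K × K)) (a i) * gr (onLine (fun _ => 1) i) *
      (algebraMap ℚ _ (b j) * gr (onLine (fun _ => 1) j)) =
      algebraMap ℚ _ (a i) * algebraMap ℚ _ (b j) * grJ (K × K) + if i = j then
        algebraMap ℚ _ (a i * b i) * ((Fintype.card K : AddMonoidAlgebra ℚ (K × K)) * lineElem i -
          grJ (K × K)) else 0 := by
    intro i j
    have := h1 i j
    rw [mul_mul_mul_comm, ← lineElem, ← lineElem, this]
    by_cases h : i = j
    · subst h; simp only [if_true, map_mul]; ring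
    · simp only [if_neg h]; ring
  simp_rw [h2, sum_add_distrib, sum_ite_eq, mem_univ, if_true, mul_sub, sum_sub_distrib,
    ← sum_mul, ← mul_sum, ← sum_mul]
  simp only [map_sub, map_mul, map_sum, mul_sum]
  have h3 : ∀ i, algebraMap ℚ (AddMonoidAlgebra ℚ (K × K)) (a i) * algebraMap ℚ _ (b i) *
      ((Fintype.card K : AddMonoidAlgebra ℚ (K × K)) * lineElem i) =
      (Fintype.card K : AddMonoidAlgebra ℚ (K × K)) *
        (algebraMap ℚ _ (a i) * algebraMap ℚ _ (b i) * lineElem i) := fun i => by ring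
  simp_rw [h3]
  ring

end Spread

/-! ### Characters, half-lines and the Paley conference matrix -/

section Characters

/-- The group-ring form of `|χ|² = |F|δ - 1`: the convolution of a nontrivial even multiplicative
character with its inverse. -/
theorem MulChar.sum_mul_inv_sub {F R : Type*} [Field F] [Fintype F] [DecidableEq F] [CommRing R]
    [IsDomain R] {χ : MulChar F R} (hχ : χ ≠ 1) (h1 : χ (-1) = 1) (z : F) :
    ∑ x, χ x * χ⁻¹ (z - x) = (if z = 0 then (Fintype.card F : R) else 0) - 1 := by
  by_cases hz : z = 0
  · subst hz
    have h2 : ∀ x, χ x * χ⁻¹ (0 - x) = (1 : MulChar F R) x := by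
      intro x
      rw [zero_sub, ← neg_one_mul x, map_mul, ← mul_inv_cancel χ, MulChar.mul_apply,
        MulChar.inv_apply', inv_neg_one, h1, one_mul]
    rw [sum_congr rfl fun x _ => h2 x, MulChar.sum_one_eq_card_units, Fintype.card_units,
      Nat.cast_sub Fintype.card_pos]
    simp
  · rw [if_neg hz, zero_sub, ← neg_inj, neg_neg]
    have h3 := jacobiSum_nontrivial_inv hχ
    rw [h1, jacobiSum] at h3
    rw [← neg_neg (1 : R), ← h3, neg_inj]
    refine (Fintype.sum_equiv (Equiv.mulLeft₀ z hz) _ _ fun x => ?_).symm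
    have h4 : χ z * χ⁻¹ z = 1 := by
      rw [← MulChar.mul_apply, mul_inv_cancel, MulChar.one_apply (isUnit_iff_ne_zero.mpr hz)]
    rw [Equiv.mulLeft₀_apply, show z - z * x = z * (1 - x) by ring, map_mul, map_mul]
    linear_combination (-(χ x * χ⁻¹ (1 - x))) * h4

theorem ringChar_ne_two_of_card {K : Type*} [Field K] [Fintype K] {n : ℕ}
    (hK : Fintype.card K = n) (hn : n % 2 = 1) : ringChar K ≠ 2 := by
  intro h
  have := FiniteField.even_card_of_char_two h
  omega

variable {K : Type*} [Field K] [Fintype K] [DecidableEq K]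

/-- The quadratic character with rational values. -/
def qchar (c : K) : ℚ := (quadraticChar K c : ℤ)

theorem qchar_zero : qchar (0 : K) = 0 := by simp [qchar]

theorem qchar_mul (a b : K) : qchar (a * b) = qchar a * qchar b := by
  simp only [qchar, map_mul, Int.cast_mul]

theorem qchar_sign {c : K} (hc : c ≠ 0) : qchar c = 1 ∨ qchar c = -1 := by
  rcases quadraticChar_dichotomy hc with h | h <;> simp [qchar, h]

theorem qchar_sq {c : K} (hc : c ≠ 0) : qchar c ^ 2 = 1 := by
  rcases qchar_sign hc with h | h <;> rw [h] <;> norm_num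

theorem qchar_sq_eq (c : K) : qchar c * qchar c = 1 - if c = 0 then 1 else 0 := by
  by_cases hc : c = 0
  · simp [hc, qchar_zero]
  · rw [← sq, qchar_sq hc, if_neg hc, sub_zero]

theorem qchar_div (a b : K) : qchar (a / b) = qchar a * qchar b := by
  by_cases hb : b = 0
  · simp [hb, qchar_zero]
  · have h : qchar a = qchar (a / b) * qchar b := by rw [← qchar_mul, div_mul_cancel₀ _ hb]
    rw [h, mul_assoc, ← sq, qchar_sq hb, mul_one]

theorem qchar_neg_one (hK : Fintype.card K % 4 = 1) : qchar (-1 : K) = 1 := by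
  have h2 : IsSquare (-1 : K) := FiniteField.isSquare_neg_one_iff.mpr (by omega)
  have := (quadraticChar_one_iff_isSquare (F := K) (neg_ne_zero.mpr one_ne_zero)).mpr h2
  simp [qchar, this]

theorem qchar_neg (hK : Fintype.card K % 4 = 1) (c : K) : qchar (-c) = qchar c := by
  rw [← neg_one_mul, qchar_mul, qchar_neg_one hK, one_mul]

theorem sum_qchar (hK : Fintype.card K % 2 = 1) : ∑ c : K, qchar c = 0 := by
  have := quadraticChar_sum_zero (ringChar_ne_two_of_card (K := K) rfl hK)
  simp only [qchar]
  exact_mod_cast this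

theorem gr_qchar_sq (hK : Fintype.card K % 4 = 1) :
    gr (qchar (K := K)) * gr qchar = (Fintype.card K : AddMonoidAlgebra ℚ K) - grJ K := by
  have h2 := ringChar_ne_two_of_card (K := K) rfl (by omega)
  have h1 : quadraticChar K (-1) = 1 :=
    (quadraticChar_one_iff_isSquare (neg_ne_zero.mpr one_ne_zero)).mpr
      (FiniteField.isSquare_neg_one_iff.mpr (by omega))
  have h3 : ∀ z : K, ∑ x, qchar x * qchar (z - x) =
      (Fintype.card K : ℚ) * (if z = 0 then 1 else 0) - 1 := by
    intro z
    have := MulChar.sum_mul_inv_sub (quadraticChar_ne_one h2) h1 z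
    rw [(quadraticChar_isQuadratic K).inv] at this
    simp only [qchar, mul_ite, mul_one, mul_zero]
    exact_mod_cast this
  rw [gr_mul]
  simp_rw [h3]
  rw [gr_sub (fun z => (Fintype.card K : ℚ) * (if z = 0 then 1 else 0)) fun _ => 1,
    gr_const_mul, gr_delta, grJ]
  simp

end Characters

section HalfLines

variable {K : Type*} [Field K] [Fintype K] [DecidableEq K]

/-- The Paley conference matrix of the projective line over `K` applied to the vector `w`, extended
from representatives of points to all vectors of the plane. -/
def paleyConf (w : Option K → ℚ) (z : K × K) : ℚ := ∑ i, w i * qchar (planeDet z (projPt i))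

/-- A half-line is annihilated by its own line, since the quadratic character sums to zero, while
its product with any other line is a function of one coordinate. -/
theorem lineElem_mul_gr_halfLines (hK : Fintype.card K % 2 = 1) (i : Option K)
    (w : Option K → ℚ) :
    lineElem i * gr (lineSum w qchar) = algebraMap ℚ _ (paleyConf w (projPt i)) *
      gr (fun z => qchar (planeDet (projPt i) z)) := by
  have h1 : ∀ j, lineElem i * gr (onLine qchar j) =
      algebraMap ℚ _ (qchar (planeDet (projPt i) (projPt j))) *
        gr (fun z => qchar (planeDet (projPt i) z)) := by
    intro j
    by_cases h : i = j
    · subst h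
      have h2 : planeDet (projPt i) (projPt i) = 0 := by simp [planeDet]; ring
      have h3 := gr_mul_grJ (qchar (K := K))
      rw [sum_qchar hK, map_zero, zero_mul] at h3
      rw [lineElem, gr_onLine, gr_onLine, ← map_mul, h2, qchar_zero, mul_comm,
        show gr (fun _ : K => (1 : ℚ)) = grJ K from rfl, h3]
      simp
    · rw [lineElem, gr_onLine_mul_of_ne _ _ h, ← gr_const_mul]
      congr 1
      funext z
      rw [qchar_div]; ring
  rw [gr_lineSum, mul_sum, paleyConf, map_sum, sum_mul]
  refine sum_congr rfl fun j _ => ?_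
  rw [map_mul, mul_left_comm, h1]; ring

/-- The product of two combinations of half-lines. The products of distinct half-lines are the
pointwise products of characters of determinants, so together they give the product of the images
under the conference matrix. -/
theorem gr_halfLines_mul (hK : Fintype.card K % 4 = 1) (w u : Option K → ℚ) :
    gr (lineSum w qchar) * gr (lineSum u qchar) =
      algebraMap ℚ _ (∑ i, w i * u i) *
        ((Fintype.card K : AddMonoidAlgebra ℚ (K × K)) - grJ (K × K)) +
      gr (fun z => paleyConf w z * paleyConf u z) := by
  have h1 : ∀ i j, gr (onLine qchar i) * gr (onLine qchar j) =
      gr (fun z : K × K => qchar (planeDet z (projPt i)) * qchar (planeDet z (projPt j))) +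
        if i = j then (Fintype.card K : AddMonoidAlgebra ℚ (K × K)) - grJ (K × K) else 0 := by
    intro i j
    by_cases h : i = j
    · subst h
      have h2 : (fun z : K × K => qchar (planeDet z (projPt i)) * qchar (planeDet z (projPt i))) =
          fun z => 1 - onLine (fun _ => 1) i z := by
        funext z; rw [qchar_sq_eq, onLine_one_eq]
      rw [if_pos rfl, h2, gr_sub, gr_onLine, gr_onLine, ← map_mul, gr_qchar_sq hK, map_sub,
        map_natCast, grJ, grJ]
      ring
    · rw [if_neg h, add_zero, gr_onLine_mul_of_ne _ _ h]
      congr 1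
      funext z
      rw [qchar_div, qchar_div, planeDet_swap z (projPt i), qchar_neg hK]
      linear_combination (qchar (planeDet z (projPt j)) * qchar (planeDet z (projPt i))) *
        qchar_sq (planeDet_projPt_ne_zero h)
  have h2 : gr (fun z => paleyConf w z * paleyConf u z) = ∑ i, ∑ j,
      algebraMap ℚ _ (w i * u j) *
        gr (fun z : K × K => qchar (planeDet z (projPt i)) * qchar (planeDet z (projPt j))) := by
    simp_rw [← gr_const_mul, ← gr_sum]
    congr 1
    funext z
    rw [paleyConf, paleyConf, sum_mul_sum]
    exact sum_congr rfl fun i _ => sum_congr rfl fun j _ => by ring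
  rw [gr_lineSum, gr_lineSum, sum_mul_sum, h2, map_sum, sum_mul, ← sum_add_distrib]
  refine sum_congr rfl fun i _ => ?_
  have h3 : ∀ j, algebraMap ℚ (AddMonoidAlgebra ℚ (K × K)) (w i) * gr (onLine qchar i) *
      (algebraMap ℚ _ (u j) * gr (onLine qchar j)) =
      (if i = j then algebraMap ℚ _ (w i * u i) *
        ((Fintype.card K : AddMonoidAlgebra ℚ (K × K)) - grJ (K × K)) else 0) +
      algebraMap ℚ _ (w i * u j) *
        gr (fun z : K × K => qchar (planeDet z (projPt i)) * qchar (planeDet z (projPt j))) := by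
    intro j
    rw [mul_mul_mul_comm, h1, ← map_mul]
    by_cases h : i = j
    · subst h; simp only [if_true]; ring
    · simp only [if_neg h]; ring
  simp_rw [h3, sum_add_distrib, sum_ite_eq, mem_univ, if_true]

theorem paleyConf_eq_lineSum {w u : Option K → ℚ} {κ : ℚ}
    (h : ∀ i, paleyConf w (projPt i) = κ * u i) (z : K × K) :
    paleyConf w z = κ * lineSum u qchar z := by
  by_cases hz : z = 0
  · subst hz
    rw [lineSum_zero, qchar_zero]
    simp [paleyConf, planeDet, qchar_zero]
  · obtain ⟨i, c, hc, rfl⟩ := exists_smul_projPt_eq z hz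
    rw [lineSum_smul_projPt _ _ _ hc, ← mul_assoc, ← h, paleyConf, paleyConf, sum_mul]
    refine sum_congr rfl fun j _ => ?_
    rw [show planeDet (c • projPt i) (projPt j) = planeDet (projPt i) (projPt j) * c by
      simp [planeDet]; ring, qchar_mul, mul_assoc]

/-- The pointwise product of two combinations of half-lines is a combination of lines with the
origin removed. -/
theorem gr_halfLines_pointwise (w u : Option K → ℚ) :
    gr (fun z => lineSum w qchar z * lineSum u qchar z) =
      ∑ i, algebraMap ℚ _ (w i * u i) * lineElem i - algebraMap ℚ _ (∑ i, w i * u i) := by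
  have h : (fun z : K × K => lineSum w qchar z * lineSum u qchar z) = fun z =>
      lineSum (fun i => w i * u i) (fun _ => 1) z -
        (∑ i, w i * u i) * (if z = 0 then 1 else 0) := by
    funext z
    by_cases hz : z = 0
    · subst hz
      simp only [lineSum_zero, qchar_zero]
      simp
    · obtain ⟨i, c, hc, rfl⟩ := exists_smul_projPt_eq z hz
      rw [lineSum_smul_projPt _ _ _ hc, lineSum_smul_projPt _ _ _ hc,
        lineSum_smul_projPt _ _ _ hc, if_neg hz]
      linear_combination (w i * u i) * qchar_sq hc
  rw [h, gr_sub, gr_lineSum, gr_const_mul, gr_delta, mul_one]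
  rfl

end HalfLines

section BalancedLines

theorem exists_signs_sum_eq_one {ι : Type*} [Fintype ι] [DecidableEq ι] (S : Finset ι)
    (hS : #S % 2 = 1) : ∃ s : ι → ℚ, (∀ i ∈ S, s i = 1 ∨ s i = -1) ∧ (∀ i ∉ S, s i = 0) ∧
      ∑ i, s i = 1 := by
  obtain ⟨T, hTS, hT⟩ := Finset.exists_subset_card_eq (s := S) (n := (#S + 1) / 2) (by omega)
  refine ⟨fun i => if i ∈ T then 1 else if i ∈ S then -1 else 0, ?_, ?_, ?_⟩
  · intro i hi
    by_cases h : i ∈ T <;> simp [h, hi]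
  · intro i hi
    have : i ∉ T := fun h => hi (hTS h)
    simp [this, hi]
  · have h1 : ∀ i, (if i ∈ T then (1 : ℚ) else if i ∈ S then -1 else 0) =
        2 * (if i ∈ T then 1 else 0) - if i ∈ S then 1 else 0 := by
      intro i
      by_cases h : i ∈ T
      · simp [h, hTS h]; norm_num
      · by_cases h' : i ∈ S <;> simp [h, h']
    rw [sum_congr rfl fun i _ => h1 i, sum_sub_distrib, ← mul_sum]
    simp only [sum_boole, filter_univ_mem, hT]
    have : 2 * ((#S + 1) / 2) = #S + 1 := by omega
    have h2 : (2 : ℚ) * (((#S + 1) / 2 : ℕ) : ℚ) = #S + 1 := by exact_mod_cast this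
    rw [h2]; ring

variable {K : Type*} [Fintype K] [DecidableEq K]

/-- If the `q + 1` lines, `q ≡ 1 mod 4`, are split into two halves by the sign `σ`, each half has
odd size and so carries a sign function with sum `1`. -/
theorem exists_balanced_signs (hK : Fintype.card K % 4 = 1) {σ : Option K → ℚ}
    (hσ : ∀ i, σ i = 1 ∨ σ i = -1) (hσ0 : ∑ i, σ i = 0) :
    ∃ s s' : Option K → ℚ, ∑ i, s i = 1 ∧ ∑ i, s' i = 1 ∧ ∀ i,
      (σ i = 1 ∧ s i = 0 ∧ (s' i = 1 ∨ s' i = -1)) ∨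
      (σ i = -1 ∧ (s i = 1 ∨ s i = -1) ∧ s' i = 0) := by
  have h1 : ∑ i, σ i = 2 * (#{i | σ i = 1} : ℚ) - Fintype.card (Option K) := by
    have : ∀ i, σ i = 2 * (if σ i = 1 then 1 else 0) - 1 := by
      intro i; rcases hσ i with h | h <;> rw [h] <;> norm_num
    rw [sum_congr rfl fun i _ => this i, sum_sub_distrib, ← mul_sum]
    simp
  have h2 : ∑ i, σ i = Fintype.card (Option K) - 2 * (#{i | σ i = -1} : ℚ) := by
    have : ∀ i, σ i = 1 - 2 * (if σ i = -1 then 1 else 0) := by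
      intro i; rcases hσ i with h | h <;> rw [h] <;> norm_num
    rw [sum_congr rfl fun i _ => this i, sum_sub_distrib, ← mul_sum]
    simp
  rw [hσ0, Fintype.card_option] at h1 h2
  have h3 : 2 * #{i | σ i = 1} = Fintype.card K + 1 := by
    have : (2 : ℚ) * (#{i | σ i = 1} : ℚ) = ((Fintype.card K + 1 : ℕ) : ℚ) := by linarith
    exact_mod_cast this
  have h4 : 2 * #{i | σ i = -1} = Fintype.card K + 1 := by
    have : (2 : ℚ) * (#{i | σ i = -1} : ℚ) = ((Fintype.card K + 1 : ℕ) : ℚ) := by linarith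
    exact_mod_cast this
  obtain ⟨s, a1, a2, a3⟩ := exists_signs_sum_eq_one {i | σ i = -1} (by omega)
  obtain ⟨s', b1, b2, b3⟩ := exists_signs_sum_eq_one {i | σ i = 1} (by omega)
  simp only [mem_filter, mem_univ, true_and] at a1 a2 b1 b2
  refine ⟨s, s', a3, b3, fun i => ?_⟩
  rcases hσ i with h | h
  · exact Or.inl ⟨h, a2 i (by rw [h]; norm_num), b1 i h⟩
  · exact Or.inr ⟨h, a1 i h, b2 i (by rw [h]; norm_num)⟩

end BalancedLines

/-! ### Building quadruples from eigenvectors of the conference matrix -/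

section EigenvectorQuadruple

variable {K : Type*} [Field K] [Fintype K] [DecidableEq K]

theorem sum_algebraMap_half {σ a : Option K → ℚ} (hσ0 : ∑ i, σ i = 0) (ε : ℚ)
    (ha : ∀ i, 2 * a i = 1 + ε * σ i) :
    2 * algebraMap ℚ (AddMonoidAlgebra ℚ (K × K)) (∑ i, a i) = Fintype.card K + 1 ∧
    2 * ∑ i, algebraMap ℚ (AddMonoidAlgebra ℚ (K × K)) (a i) * lineElem i =
      Fintype.card K + grJ (K × K) +
        algebraMap ℚ _ ε * ∑ i, algebraMap ℚ _ (σ i) * lineElem i := by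
  have h2 : (2 : AddMonoidAlgebra ℚ (K × K)) = algebraMap ℚ _ 2 := (map_ofNat _ 2).symm
  constructor
  · rw [h2, ← map_mul, mul_sum, sum_congr rfl fun i _ => ha i, sum_add_distrib, ← mul_sum, hσ0]
    simp only [sum_const, card_univ, Fintype.card_option, nsmul_eq_mul, mul_one, mul_zero,
      add_zero, map_natCast]
    push_cast
    rfl
  · rw [mul_sum, mul_sum, ← sum_lineElem, ← sum_add_distrib]
    refine sum_congr rfl fun i _ => ?_
    rw [h2, ← mul_assoc, ← map_mul, ha, map_add, map_mul, map_one]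
    ring

/-- Sign functions `s`, `s'` with sum `1` on the two halves of the lines cut out by `σ`, together
with what this means for the elements `X = ∑ s i • L i`, `X' = ∑ s' i • L i` and `∑ σ i • L i`. -/
theorem gr_balancedLines {σ s s' : Option K → ℚ} (hσ0 : ∑ i, σ i = 0) (hs : ∑ i, s i = 1)
    (hs' : ∑ i, s' i = 1)
    (h : ∀ i, (σ i = 1 ∧ s i = 0 ∧ (s' i = 1 ∨ s' i = -1)) ∨
      (σ i = -1 ∧ (s i = 1 ∨ s i = -1) ∧ s' i = 0)) :
    gr (lineSum s fun _ => 1) * gr (lineSum s' fun _ => 1) = grJ (K × K) ∧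
    2 * gr (lineSum s fun _ => 1) ^ 2 = (Fintype.card K : AddMonoidAlgebra ℚ (K × K)) ^ 2 +
      grJ (K × K) - Fintype.card K * (∑ i, algebraMap ℚ _ (σ i) * lineElem i) ∧
    2 * gr (lineSum s' fun _ => 1) ^ 2 = (Fintype.card K : AddMonoidAlgebra ℚ (K × K)) ^ 2 +
      grJ (K × K) + Fintype.card K * (∑ i, algebraMap ℚ _ (σ i) * lineElem i) := by
  have e0 : ∀ i, s i * s' i = 0 := by
    intro i; rcases h i with ⟨-, h1, -⟩ | ⟨-, -, h1⟩ <;> simp [h1]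
  have e1 : ∀ i, 2 * (s i * s i) = 1 + -1 * σ i := by
    intro i; rcases h i with ⟨h1, h2, -⟩ | ⟨h1, h2 | h2, -⟩ <;> rw [h1, h2] <;> norm_num
  have e2 : ∀ i, 2 * (s' i * s' i) = 1 + 1 * σ i := by
    intro i; rcases h i with ⟨h1, -, h2 | h2⟩ | ⟨h1, -, h2⟩ <;> rw [h1, h2] <;> norm_num
  obtain ⟨a1, a2⟩ := sum_algebraMap_half (a := fun i => s i * s i) hσ0 _ e1
  obtain ⟨b1, b2⟩ := sum_algebraMap_half (a := fun i => s' i * s' i) hσ0 _ e2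
  rw [map_neg, map_one] at a2
  rw [map_one] at b2
  refine ⟨?_, ?_, ?_⟩
  · rw [gr_lineSum_mul_lineSum]
    simp_rw [e0, hs, hs']
    simp only [map_zero, zero_mul, sum_const_zero, mul_zero, mul_one, sub_zero, map_one, one_mul,
      zero_add]
  · rw [sq, gr_lineSum_mul_lineSum, hs, map_sub, mul_one, map_one]
    linear_combination (Fintype.card K : AddMonoidAlgebra ℚ (K × K)) * a2 - grJ (K × K) * a1
  · rw [sq, gr_lineSum_mul_lineSum, hs', map_sub, mul_one, map_one]
    linear_combination (Fintype.card K : AddMonoidAlgebra ℚ (K × K)) * b2 - grJ (K × K) * b1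

/-- Two vectors with complementary supports on the projective line that are interchanged, up to the
factor `m = √|K|`, by the Paley conference matrix yield a building quadruple on the plane: `X ± Y`
and `X' ± Y'`, where `Y`, `Y'` are the half-line sums of the two vectors and `X`, `X'` are signed
sums of lines on the complementary halves. -/
theorem exists_isBuildingQuadruple_of_paleyConf (hK : Fintype.card K % 4 = 1) {m : ℚ}
    (hm : m ^ 2 = Fintype.card K) {y y' : Option K → ℚ}
    (hy : ∀ i, ((y i = 1 ∨ y i = -1) ∧ y' i = 0) ∨ (y i = 0 ∧ (y' i = 1 ∨ y' i = -1)))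
    (h1 : ∀ i, paleyConf y (projPt i) = m * y' i) (h2 : ∀ i, paleyConf y' (projPt i) = m * y i) :
    ∃ f : Fin 4 → K × K → ℚ, IsBuildingQuadruple f := by
  have hm0 : m ≠ 0 := by
    rintro rfl
    have : (0 : ℚ) < Fintype.card K := by exact_mod_cast Fintype.card_pos
    linarith
  set σ : Option K → ℚ := fun i => y i * y i - y' i * y' i with hσdef
  have hσ : ∀ i, σ i = 1 ∨ σ i = -1 := by
    intro i
    rcases hy i with ⟨a | a, b⟩ | ⟨a, b | b⟩ <;> simp [hσdef, a, b]
  have hσ0 : ∑ i, σ i = 0 := by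
    -- The conference matrix is symmetric, so `m ∑ y'² = ⟨y', Cy⟩ = ⟨Cy', y⟩ = m ∑ y²`.
    have h3 : ∑ i, y' i * paleyConf y (projPt i) = ∑ i, y i * paleyConf y' (projPt i) := by
      simp only [paleyConf, mul_sum]
      rw [sum_comm]
      refine sum_congr rfl fun i _ => sum_congr rfl fun j _ => ?_
      rw [planeDet_swap (projPt i), qchar_neg hK]; ring
    simp_rw [h1, h2] at h3
    have h4 : m * ∑ i, σ i = 0 := by
      rw [mul_sum, ← sub_eq_zero.mpr h3.symm, ← sum_sub_distrib]
      exact sum_congr rfl fun i _ => by rw [hσdef]; ring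
    exact (mul_eq_zero.mp h4).resolve_left hm0
  obtain ⟨s, s', hs, hs', hss⟩ := exists_balanced_signs hK hσ hσ0
  obtain ⟨XX', XX, X'X'⟩ := gr_balancedLines hσ0 hs hs' hss
  set X := lineSum s fun _ : K => 1
  set X' := lineSum s' fun _ : K => 1
  set Y := lineSum y (qchar (K := K))
  set Y' := lineSum y' (qchar (K := K))
  have hyσ : ∀ i, (σ i = 1 ∧ (y i = 1 ∨ y i = -1) ∧ y' i = 0) ∨
      (σ i = -1 ∧ y i = 0 ∧ (y' i = 1 ∨ y' i = -1)) := by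
    intro i
    rcases hy i with ⟨a | a, b⟩ | ⟨a, b | b⟩ <;> simp [hσdef, a, b]
  have cY := paleyConf_eq_lineSum h1
  have cY' := paleyConf_eq_lineSum h2
  have XY' : gr X * gr Y' = 0 := by
    rw [gr_lineSum, sum_mul]
    refine sum_eq_zero fun i _ => ?_
    have h5 : s i * (m * y i) = 0 := by
      rcases hss i with ⟨-, a, -⟩ | ⟨a, -, -⟩
      · simp [a]
      · rcases hyσ i with ⟨b, -, -⟩ | ⟨-, b, -⟩
        · rw [a] at b; norm_num at b
        · simp [b]
    rw [mul_assoc, ← lineElem, lineElem_mul_gr_halfLines (by omega), h2, ← mul_assoc, ← map_mul, h5,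
      map_zero, zero_mul]
  have X'Y : gr X' * gr Y = 0 := by
    rw [gr_lineSum, sum_mul]
    refine sum_eq_zero fun i _ => ?_
    have h5 : s' i * (m * y' i) = 0 := by
      rcases hss i with ⟨a, -, -⟩ | ⟨-, -, a⟩
      · rcases hyσ i with ⟨-, -, b⟩ | ⟨b, -, -⟩
        · simp [b]
        · rw [a] at b; norm_num at b
      · simp [a]
    rw [mul_assoc, ← lineElem, lineElem_mul_gr_halfLines (by omega), h1, ← mul_assoc, ← map_mul, h5,
      map_zero, zero_mul]
  have e0 : ∀ i, y i * y' i = 0 := by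
    intro i; rcases hy i with ⟨-, b⟩ | ⟨b, -⟩ <;> simp [b]
  have e1 : ∀ i, 2 * (y i * y i) = 1 + 1 * σ i := by
    intro i; rcases hyσ i with ⟨h1, h2 | h2, -⟩ | ⟨h1, h2, -⟩ <;> rw [h1, h2] <;> norm_num
  have e2 : ∀ i, 2 * (y' i * y' i) = 1 + -1 * σ i := by
    intro i; rcases hyσ i with ⟨h1, -, h2⟩ | ⟨h1, -, h2 | h2⟩ <;> rw [h1, h2] <;> norm_num
  obtain ⟨a1, a2⟩ := sum_algebraMap_half (a := fun i => y i * y i) hσ0 _ e1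
  obtain ⟨b1, b2⟩ := sum_algebraMap_half (a := fun i => y' i * y' i) hσ0 _ e2
  rw [map_neg, map_one] at b2
  rw [map_one] at a2
  have mul_conf : ∀ (a b c d : Option K → ℚ), (∀ z, paleyConf a z = m * lineSum c qchar z) →
      (∀ z, paleyConf b z = m * lineSum d qchar z) →
      gr (lineSum a qchar) * gr (lineSum b qchar) =
      algebraMap ℚ _ (∑ i, a i * b i) *
        ((Fintype.card K : AddMonoidAlgebra ℚ (K × K)) - grJ (K × K)) +
      Fintype.card K * (∑ i, algebraMap ℚ _ (c i * d i) * lineElem i -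
        algebraMap ℚ _ (∑ i, c i * d i)) := by
    intro a b c d ha hb
    rw [gr_halfLines_mul hK, ← gr_halfLines_pointwise]
    congr 1
    rw [← map_natCast (algebraMap ℚ (AddMonoidAlgebra ℚ (K × K))), ← hm, ← gr_const_mul]
    congr 1
    funext z
    rw [ha, hb]; ring
  have YY' : gr Y * gr Y' = 0 := by
    rw [mul_conf y y' y' y cY cY']
    simp_rw [mul_comm (y' _), e0]
    simp
  have YY : 2 * gr Y ^ 2 = (Fintype.card K : AddMonoidAlgebra ℚ (K × K)) ^ 2 -
      grJ (K × K) - Fintype.card K * (∑ i, algebraMap ℚ _ (σ i) * lineElem i) := by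
    rw [sq, mul_conf y y y' y' cY cY]
    linear_combination ((Fintype.card K : AddMonoidAlgebra ℚ (K × K)) - grJ (K × K)) * a1 +
      Fintype.card K * (b2 - b1)
  have Y'Y' : 2 * gr Y' ^ 2 = (Fintype.card K : AddMonoidAlgebra ℚ (K × K)) ^ 2 -
      grJ (K × K) + Fintype.card K * (∑ i, algebraMap ℚ _ (σ i) * lineElem i) := by
    rw [sq, mul_conf y' y' y y cY' cY']
    linear_combination ((Fintype.card K : AddMonoidAlgebra ℚ (K × K)) - grJ (K × K)) * b1 +
      Fintype.card K * (a2 - a1)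
  have ht := two_mul_algebraMap_half (K × K)
  set t := algebraMap ℚ (AddMonoidAlgebra ℚ (K × K)) (1 / 2)
  -- The pairs `(X, Y)` and `(X', Y')` take the values `(1, 0)` at the origin; elsewhere, exactly
  -- one entry of each is nonzero, and it is the first of one pair and the second of the other.
  have hval : ∀ z : K × K, (z = 0 ∧ X z = 1 ∧ Y z = 0 ∧ X' z = 1 ∧ Y' z = 0) ∨
      (z ≠ 0 ∧ X z = 0 ∧ (Y z = 1 ∨ Y z = -1) ∧ (X' z = 1 ∨ X' z = -1) ∧ Y' z = 0) ∨
      (z ≠ 0 ∧ (X z = 1 ∨ X z = -1) ∧ Y z = 0 ∧ X' z = 0 ∧ (Y' z = 1 ∨ Y' z = -1)) := by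
    intro z
    by_cases hz : z = 0
    · left
      subst hz
      simp only [X, Y, X', Y', lineSum_zero, qchar_zero, hs, hs', mul_zero, mul_one, and_self]
    · right
      obtain ⟨i, c, hc, rfl⟩ := exists_smul_projPt_eq z hz
      simp only [X, Y, X', Y', lineSum_smul_projPt _ _ _ hc, mul_one]
      have hsgn : ∀ r : ℚ, (r = 1 ∨ r = -1) → (r * qchar c = 1 ∨ r * qchar c = -1) := by
        rintro r (rfl | rfl) <;> rcases qchar_sign hc with h | h <;> rw [h] <;> norm_num
      rcases hss i with ⟨a, b, d⟩ | ⟨a, b, d⟩ <;> rcases hyσ i with ⟨a', b', d'⟩ | ⟨a', b', d'⟩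
      · left
        exact ⟨hz, b, hsgn _ b', d, by rw [d', zero_mul]⟩
      · rw [a] at a'; norm_num at a'
      · rw [a] at a'; norm_num at a'
      · right
        exact ⟨hz, b, by rw [b', zero_mul], d, hsgn _ d'⟩
  have hXe : ∀ z, X (-z) = X z := lineSum_neg s fun _ => rfl
  have hX'e : ∀ z, X' (-z) = X' z := lineSum_neg s' fun _ => rfl
  have hYe : ∀ z, Y (-z) = Y z := lineSum_neg y (qchar_neg hK)
  have hY'e : ∀ z, Y' (-z) = Y' z := lineSum_neg y' (qchar_neg hK)
  refine ⟨![fun z => X z + Y z, fun z => X z - Y z, fun z => X' z + Y' z, fun z => X' z - Y' z],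
    ?_, ?_, ?_, ?_, ?_, ?_⟩
  · intro i z
    fin_cases i <;> simp only [Fin.zero_eta, Fin.mk_one, Fin.reduceFinMk, Matrix.cons_val] <;>
      rcases hval z with ⟨-, a, b, c, d⟩ | ⟨-, a, b | b, c | c, d⟩ | ⟨-, a | a, b, c, d | d⟩ <;>
      simp [a, b, c, d]
  · intro i z
    fin_cases i <;> simp [hXe, hX'e, hYe, hY'e]
  · rcases hval 0 with ⟨-, a, b, c, d⟩ | ⟨h, -⟩ | ⟨h, -⟩
    · simp [Fin.prod_univ_four, a, b, c, d]
    · exact (h rfl).elim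
    · exact (h rfl).elim
  · intro z hz
    rcases hval z with ⟨h, -⟩ | ⟨-, a, b | b, c | c, d⟩ | ⟨-, a | a, b, c, d | d⟩
    · exact (hz h).elim
    all_goals simp [Fin.prod_univ_four, a, b, c, d]
  · have key : ∀ i j : Fin 4, i < j →
        gr ((![fun z => X z + Y z, fun z => X z - Y z, fun z => X' z + Y' z,
          fun z => X' z - Y' z] : Fin 4 → K × K → ℚ) i) *
        gr ((![fun z => X z + Y z, fun z => X z - Y z, fun z => X' z + Y' z,
          fun z => X' z - Y' z] : Fin 4 → K × K → ℚ) j) = grJ (K × K) := by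
      intro i j hij
      fin_cases i <;> fin_cases j <;> first | exact absurd hij (by decide) | skip
      all_goals
        simp only [Fin.zero_eta, Fin.mk_one, Fin.reduceFinMk, Matrix.cons_val, gr_add, gr_sub]
      · linear_combination t * (XX - YY) - (gr X ^ 2 - gr Y ^ 2 - grJ (K × K)) * ht
      · linear_combination XX' + XY' + X'Y + YY'
      · linear_combination XX' - XY' + X'Y - YY'
      · linear_combination XX' + XY' - X'Y - YY'
      · linear_combination XX' - XY' - X'Y + YY'
      · linear_combination t * (X'X' - Y'Y') - (gr X' ^ 2 - gr Y' ^ 2 - grJ (K × K)) * ht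
    intro i j hij
    rcases lt_or_gt_of_ne hij with h | h
    · exact key i j h
    · rw [mul_comm]; exact key j i h
  · simp only [Fin.sum_univ_four, Matrix.cons_val, gr_add, gr_sub, Fintype.card_prod]
    push_cast
    linear_combination XX + YY + X'X' + Y'Y'

end EigenvectorQuadruple

/-! ### Building quadruples of order `p⁴` -/

section

variable {K : Type*} [Field K] [Fintype K] [DecidableEq K]

theorem paleyConf_none (w : Option K → ℚ) :
    paleyConf w (projPt none) = ∑ α, w (some α) := by
  have : qchar (1 : K) = 1 := by simp [qchar]
  simp [paleyConf, planeDet, projPt, Fintype.sum_option, qchar_zero, this]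

theorem paleyConf_some (hE : Fintype.card K % 4 = 1)
    (w : Option K → ℚ) (z : K) :
    paleyConf w (projPt (some z)) = w none + ∑ α, w (some α) * qchar (z - α) := by
  simp [paleyConf, planeDet, projPt, Fintype.sum_option, qchar_neg_one hE]

end

section QuadraticExtension

variable {F : Type*} [Field F] [Fintype F] [DecidableEq F] {d : F}

/-- A quadratic extension of a finite field is finite. -/
noncomputable instance QuadraticAlgebra.instFintypeOfFintype {R : Type*} [Fintype R] (a b : R) :
    Fintype (QuadraticAlgebra R a b) :=
  Fintype.ofEquiv _ (QuadraticAlgebra.equivProd a b).symm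

theorem QuadraticAlgebra.fintype_card_eq {R : Type*} [Fintype R] (a b : R) :
    Fintype.card (QuadraticAlgebra R a b) = Fintype.card R ^ 2 := by
  rw [Fintype.card_congr (QuadraticAlgebra.equivProd a b), Fintype.card_prod, sq]

theorem QuadraticAlgebra.fintype_sum_eq {R M : Type*} [Fintype R] [AddCommMonoid M] {a b : R}
    (g : QuadraticAlgebra R a b → M) : ∑ z, g z = ∑ s, ∑ r, g ⟨r, s⟩ := by
  rw [sum_comm, ← Fintype.sum_prod_type' fun r s => g ⟨r, s⟩]
  exact Fintype.sum_equiv (QuadraticAlgebra.equivProd a b) _ _ fun z => rfl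

/-- A `±1` vector on the projective line over the quadratic extension, namely `1` on the projective
line over the base field `F` and the quadratic character of the imaginary part elsewhere. -/
def sublineVec : Option (QuadraticAlgebra F d 0) → ℚ
  | none => 1
  | some α => if α.im = 0 then 1 else qchar α.im

theorem sum_sublineVec_values (hF : Fintype.card F % 2 = 1) :
    ∑ s : F, (if s = 0 then 1 else qchar s) = 1 := by
  have h : ∀ s : F, (if s = 0 then 1 else qchar s) = (if s = 0 then 1 else 0) + qchar s := by
    intro s
    by_cases hs : s = 0
    · simp [hs, qchar_zero]
    · simp [hs]
  rw [sum_congr rfl fun s _ => h s, sum_add_distrib, sum_qchar hF]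
  simp

theorem sum_sublineVec (hF : Fintype.card F % 2 = 1) :
    ∑ α : QuadraticAlgebra F d 0, sublineVec (some α) = Fintype.card F := by
  simp only [sublineVec]
  rw [QuadraticAlgebra.fintype_sum_eq]
  simp only [sum_const, card_univ, nsmul_eq_mul]
  rw [← mul_sum, sum_sublineVec_values hF, mul_one]

theorem sublineVec_sign (i : Option (QuadraticAlgebra F d 0)) :
    sublineVec i = 1 ∨ sublineVec i = -1 := by
  rcases i with _ | α
  · exact Or.inl rfl
  · simp only [sublineVec]
    split_ifs with h
    · exact Or.inl rfl
    · exact qchar_sign h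

theorem exists_quadraticExtension (hF : Fintype.card F % 2 = 1) :
    ∃ d : F, ∀ r : F, r ^ 2 ≠ d + 0 * r := by
  obtain ⟨d, hd⟩ := quadraticChar_exists_neg_one (ringChar_ne_two_of_card (K := F) rfl hF)
  refine ⟨d, fun r hr => quadraticChar_neg_one_iff_not_isSquare.mp hd ⟨r, ?_⟩⟩
  rw [← sq, hr]; ring

variable [hd : Fact (∀ r : F, r ^ 2 ≠ d + 0 * r)]

/-- Every element of the base field is a square in a quadratic extension. -/
theorem qchar_algebraMap_quadratic (hF : Fintype.card F % 2 = 1) {c : F} (hc : c ≠ 0) :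
    qchar (algebraMap F (QuadraticAlgebra F d 0) c) = 1 := by
  have hE : Fintype.card (QuadraticAlgebra F d 0) % 2 = 1 := by
    rw [QuadraticAlgebra.fintype_card_eq, Nat.pow_mod, hF]
  have h2 := ringChar_ne_two_of_card (K := QuadraticAlgebra F d 0) rfl hE
  have hc' : algebraMap F (QuadraticAlgebra F d 0) c ≠ 0 := by simpa using hc
  have h1 : algebraMap F (QuadraticAlgebra F d 0) c ^
      (Fintype.card (QuadraticAlgebra F d 0) / 2) = 1 := by
    obtain ⟨k, hk⟩ : ∃ k, Fintype.card F = 2 * k + 1 := ⟨Fintype.card F / 2, by omega⟩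
    have h3 : Fintype.card (QuadraticAlgebra F d 0) / 2 = (Fintype.card F - 1) * (k + 1) := by
      rw [QuadraticAlgebra.fintype_card_eq, hk, Nat.add_sub_cancel,
        show (2 * k + 1) ^ 2 = 2 * (2 * k * (k + 1)) + 1 by ring]
      omega
    rw [h3, pow_mul, ← map_pow, FiniteField.pow_card_sub_one_eq_one c hc, map_one, one_pow]
  have h4 := quadraticChar_eq_pow_of_char_ne_two h2 hc'
  rw [if_pos h1] at h4
  simp [qchar, h4]

/-- The quadratic character of the extension sums to `-1` along every affine line parallel to the
base field that does not pass through the origin. -/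
theorem sum_qchar_quadratic (hF : Fintype.card F % 2 = 1) (t : F) :
    ∑ r, qchar (⟨r, t⟩ : QuadraticAlgebra F d 0) =
      (if t = 0 then (Fintype.card F : ℚ) else 0) - 1 := by
  have hE : Fintype.card (QuadraticAlgebra F d 0) % 2 = 1 := by
    rw [QuadraticAlgebra.fintype_card_eq, Nat.pow_mod, hF]
  have h0 : ∑ r, qchar (⟨r, 0⟩ : QuadraticAlgebra F d 0) = Fintype.card F - 1 := by
    have h : ∀ r : F, qchar (⟨r, 0⟩ : QuadraticAlgebra F d 0) = 1 - if r = 0 then 1 else 0 := by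
      intro r
      by_cases hr : r = 0
      · subst hr
        rw [show (⟨0, 0⟩ : QuadraticAlgebra F d 0) = 0 from rfl, qchar_zero]; simp
      · rw [if_neg hr, sub_zero]
        exact qchar_algebraMap_quadratic hF hr
    rw [sum_congr rfl fun r _ => h r, sum_sub_distrib]
    simp
  have h1 : ∀ s : F, s ≠ 0 → ∑ r, qchar (⟨r, s⟩ : QuadraticAlgebra F d 0) =
      ∑ r, qchar (⟨r, 1⟩ : QuadraticAlgebra F d 0) := by
    intro s hs
    refine (Fintype.sum_equiv (Equiv.mulLeft₀ s hs) _ _ fun r => ?_).symm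
    have : (⟨s * r, s⟩ : QuadraticAlgebra F d 0) = algebraMap F _ s * ⟨r, 1⟩ := by
      rw [QuadraticAlgebra.algebraMap_eq]
      ext <;> simp
    rw [Equiv.mulLeft₀_apply, this, qchar_mul, qchar_algebraMap_quadratic hF hs, one_mul]
  by_cases ht : t = 0
  · subst ht; simpa using h0
  · have h2 := sum_qchar (K := QuadraticAlgebra F d 0) hE
    rw [QuadraticAlgebra.fintype_sum_eq, ← add_sum_erase _ _ (mem_univ (0 : F)), h0,
      sum_congr rfl fun s hs => h1 s (ne_of_mem_erase hs), sum_const,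
      card_erase_of_mem (mem_univ _), card_univ, nsmul_eq_mul,
      Nat.cast_sub Fintype.card_pos] at h2
    have h3 : (1 : ℚ) < Fintype.card F := by exact_mod_cast Fintype.one_lt_card
    rw [if_neg ht, h1 t ht, zero_sub]
    have h4 : ((Fintype.card F : ℚ) - 1) *
        (∑ r, qchar (⟨r, 1⟩ : QuadraticAlgebra F d 0) + 1) = 0 := by
      push_cast at h2; linarith
    rcases mul_eq_zero.mp h4 with h | h <;> linarith

theorem one_add_sum_qchar_sub_mul_sublineVec (hF : Fintype.card F % 2 = 1)
    (z : QuadraticAlgebra F d 0) :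
    1 + ∑ α, sublineVec (some α) * qchar (z - α) = Fintype.card F * sublineVec (some z) := by
  simp only [sublineVec]
  rw [QuadraticAlgebra.fintype_sum_eq]
  have h1 : ∀ s : F, ∑ r, (if s = 0 then 1 else qchar s) *
      qchar (z - (⟨r, s⟩ : QuadraticAlgebra F d 0)) = (if s = 0 then 1 else qchar s) *
        ((if z.im = s then (Fintype.card F : ℚ) else 0) - 1) := by
    intro s
    rw [← mul_sum]
    congr 1
    rw [← if_congr (sub_eq_zero (a := z.im) (b := s)) rfl rfl, ← sum_qchar_quadratic (d := d) hF]
    exact Fintype.sum_equiv (Equiv.subLeft z.re) _ _ fun r => rfl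
  rw [sum_congr rfl fun s _ => h1 s]
  simp only [mul_sub, sum_sub_distrib, mul_one, sum_sublineVec_values hF, mul_ite, mul_zero,
    sum_ite_eq, mem_univ, if_true]
  split_ifs <;> ring

/-- The image of `sublineVec` under a projectivity of nonsquare determinant `ω`. -/
def twistedSublineVec (ω : QuadraticAlgebra F d 0) : Option (QuadraticAlgebra F d 0) → ℚ
  | none => -1
  | some α => sublineVec (some (ω * α))

/-- The vector `sublineVec` is an eigenvector of the Paley conference matrix with eigenvalue
`|F| = √|E|`. -/
theorem paleyConf_sublineVec (hF : Fintype.card F % 2 = 1)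
    (hE : Fintype.card (QuadraticAlgebra F d 0) % 4 = 1) (i : Option (QuadraticAlgebra F d 0)) :
    paleyConf sublineVec (projPt i) = Fintype.card F * sublineVec i := by
  rcases i with _ | z
  · rw [paleyConf_none, sum_sublineVec hF]; simp [sublineVec]
  · rw [paleyConf_some hE, ← one_add_sum_qchar_sub_mul_sublineVec hF]
    rfl

/-- Twisting by a nonsquare determinant negates the conference matrix, hence the eigenvalue. -/
theorem paleyConf_twistedSublineVec (hF : Fintype.card F % 2 = 1)
    (hE : Fintype.card (QuadraticAlgebra F d 0) % 4 = 1) {ω : QuadraticAlgebra F d 0}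
    (hω : qchar ω = -1) (i : Option (QuadraticAlgebra F d 0)) :
    paleyConf (twistedSublineVec ω) (projPt i) = -(Fintype.card F * twistedSublineVec ω i) := by
  have hω0 : ω ≠ 0 := by
    rintro rfl; rw [qchar_zero] at hω; norm_num at hω
  rcases i with _ | z
  · rw [paleyConf_none, ← sum_sublineVec (d := d) hF]
    simp only [twistedSublineVec, mul_neg, mul_one, neg_neg]
    exact Fintype.sum_equiv (Equiv.mulLeft₀ ω hω0) _ _ fun α => rfl
  · rw [paleyConf_some hE]
    simp only [twistedSublineVec]
    rw [← one_add_sum_qchar_sub_mul_sublineVec hF, neg_add, ← sum_neg_distrib]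
    congr 1
    refine Fintype.sum_equiv (Equiv.mulLeft₀ ω hω0) _ _ fun α => ?_
    rw [Equiv.mulLeft₀_apply, ← mul_sub, qchar_mul, hω]
    ring

/-- Half the sum and half the difference of the two eigenvectors, with eigenvalues `±|F|`, have
complementary supports and are interchanged by the conference matrix up to the factor `|F|`. -/
theorem exists_isBuildingQuadruple_quadratic (hF : Fintype.card F % 2 = 1) :
    ∃ f : Fin 4 → QuadraticAlgebra F d 0 × QuadraticAlgebra F d 0 → ℚ,
      IsBuildingQuadruple f := by
  have hE : Fintype.card (QuadraticAlgebra F d 0) % 4 = 1 := by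
    rw [QuadraticAlgebra.fintype_card_eq, Nat.pow_mod]
    have : Fintype.card F % 4 = 1 ∨ Fintype.card F % 4 = 3 := by omega
    rcases this with h | h <;> rw [h]
  obtain ⟨ω, hω⟩ : ∃ ω : QuadraticAlgebra F d 0, qchar ω = -1 := by
    obtain ⟨ω, hω⟩ := quadraticChar_exists_neg_one
      (ringChar_ne_two_of_card (K := QuadraticAlgebra F d 0) rfl (by omega))
    exact ⟨ω, by simp [qchar, hω]⟩
  have hlin : ∀ (a b : ℚ) (i : Option (QuadraticAlgebra F d 0)),
      paleyConf (fun j => a * sublineVec j + b * twistedSublineVec ω j) (projPt i) =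
        a * paleyConf sublineVec (projPt i) + b * paleyConf (twistedSublineVec ω) (projPt i) := by
    intro a b i
    simp only [paleyConf, mul_sum, ← sum_add_distrib]
    exact sum_congr rfl fun j _ => by ring
  have htw : ∀ i : Option (QuadraticAlgebra F d 0),
      twistedSublineVec ω i = 1 ∨ twistedSublineVec ω i = -1 := by
    rintro (_ | α)
    · exact Or.inr rfl
    · exact sublineVec_sign (some (ω * α))
  refine exists_isBuildingQuadruple_of_paleyConf (K := QuadraticAlgebra F d 0) hE
    (m := Fintype.card F)
    (y := fun j => 1 / 2 * sublineVec j + 1 / 2 * twistedSublineVec ω j)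
    (y' := fun j => 1 / 2 * sublineVec j + -1 / 2 * twistedSublineVec ω j)
    (by rw [QuadraticAlgebra.fintype_card_eq]; push_cast; rfl) ?_ ?_ ?_
  · intro i
    rcases sublineVec_sign i with a | a <;> rcases htw i with b | b <;>
      rw [a, b] <;> norm_num
  · intro i
    rw [hlin, paleyConf_sublineVec hF hE, paleyConf_twistedSublineVec hF hE hω]; ring
  · intro i
    rw [hlin, paleyConf_sublineVec hF hE, paleyConf_twistedSublineVec hF hE hω]; ring

end QuadraticExtension

/-! ### Orders of building quadruples -/

section OrderThree

variable {K : Type*} [Field K] [Fintype K] [DecidableEq K]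

theorem lineElem_mul_grJ (i : Option K) :
    lineElem i * grJ (K × K) = (Fintype.card K : AddMonoidAlgebra ℚ (K × K)) * grJ (K × K) := by
  obtain ⟨j, hj⟩ := exists_ne i
  rw [← lineElem_mul_of_ne hj.symm, ← mul_assoc, lineElem_sq, mul_assoc]

theorem grJ_mul_grJ (G : Type*) [AddCommGroup G] [Fintype G] :
    grJ G * grJ G = (Fintype.card G : AddMonoidAlgebra ℚ G) * grJ G := by
  have h := gr_mul_grJ fun _ : G => (1 : ℚ)
  simpa [grJ] using h

/-- The complements of the four lines through the origin of the affine plane of order three. -/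
theorem exists_isBuildingQuadruple_of_card_eq_three (hK : Fintype.card K = 3) :
    ∃ f : Fin 4 → K × K → ℚ, IsBuildingQuadruple f := by
  have e : Fin 4 ≃ Option K :=
    (Fintype.equivFinOfCardEq (by rw [Fintype.card_option, hK])).symm
  have hgr : ∀ i, gr (fun z => 1 - 2 * onLine (fun _ => 1) (e i) z) =
      grJ (K × K) - 2 * lineElem (e i) := by
    intro i
    rw [gr_sub (fun _ => 1), gr_const_mul, map_ofNat]
    rfl
  have hJ : grJ (K × K) * grJ (K × K) = 9 * grJ (K × K) := by
    rw [grJ_mul_grJ, Fintype.card_prod, hK]; norm_num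
  have hL : ∀ i : Option K, lineElem i * grJ (K × K) = 3 * grJ (K × K) := by
    intro i; rw [lineElem_mul_grJ, hK]; norm_num
  refine ⟨fun i z => 1 - 2 * onLine (fun _ => 1) (e i) z, ?_, ?_, ?_, ?_, ?_, ?_⟩
  · intro i z
    rw [onLine_one_eq]
    split_ifs <;> norm_num
  · intro i z
    rw [onLine_neg fun _ => rfl]
  · simp only [onLine_zero]
    norm_num
  · intro z hz
    obtain ⟨j, c, hc, rfl⟩ := exists_smul_projPt_eq z hz
    simp only [onLine_smul_projPt _ _ _ hc]
    rw [Equiv.prod_comp e fun i => 1 - 2 * (if i = j then (1 : ℚ) else 0),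
      Finset.prod_eq_single j]
    · norm_num
    · intro b _ hb; simp [hb]
    · simp
  · intro i j hij
    rw [hgr, hgr]
    have h := lineElem_mul_of_ne (e.injective.ne hij)
    linear_combination hJ - 2 * hL (e i) - 2 * hL (e j) + 4 * h
  · have h : ∀ i, gr (fun z => 1 - 2 * onLine (fun _ => 1) (e i) z) ^ 2 =
        12 * lineElem (e i) - 3 * grJ (K × K) := by
      intro i
      have h := lineElem_sq (e i)
      rw [hK] at h
      push_cast at h
      rw [hgr]
      linear_combination hJ - 4 * hL (e i) + 4 * h
    rw [sum_congr rfl fun i _ => h i, sum_sub_distrib, ← mul_sum, Equiv.sum_comp e lineElem,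
      sum_lineElem, Fintype.card_prod, hK]
    simp only [sum_const, card_univ, Fintype.card_fin, nsmul_eq_mul]
    push_cast
    ring

end OrderThree

section Order

/-- There is a building quadruple on some abelian group of order `N`. -/
def IsBuildingOrder (N : ℕ) : Prop :=
  ∃ (H : Type) (_ : AddCommGroup H) (_ : Fintype H) (f : Fin 4 → H → ℚ),
    Fintype.card H = N ∧ IsBuildingQuadruple f

theorem isBuildingOrder_one : IsBuildingOrder 1 :=
  ⟨Unit, inferInstance, inferInstance, _, rfl, isBuildingQuadruple_one⟩

theorem isBuildingOrder_nine : IsBuildingOrder 9 := by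
  have : Fact (Nat.Prime 3) := ⟨Nat.prime_three⟩
  obtain ⟨f, hf⟩ := exists_isBuildingQuadruple_of_card_eq_three (ZMod.card 3)
  exact ⟨ZMod 3 × ZMod 3, inferInstance, inferInstance, f, by simp [ZMod.card], hf⟩

theorem IsBuildingOrder.mul {M N : ℕ} (hM : IsBuildingOrder M) (hN : IsBuildingOrder N) :
    IsBuildingOrder (M * N) := by
  obtain ⟨H, _, _, f, rfl, hf⟩ := hM
  obtain ⟨K, _, _, g, rfl, hg⟩ := hN
  exact ⟨H × K, inferInstance, inferInstance, _, Fintype.card_prod H K, hf.compose hg⟩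

/-- The group is the plane over the field with `p²` elements. -/
theorem isBuildingOrder_prime_pow_four {p : ℕ} (hp : p.Prime) (h2 : p % 2 = 1) :
    IsBuildingOrder (p ^ 4) := by
  have : Fact p.Prime := ⟨hp⟩
  have hF : Fintype.card (ZMod p) % 2 = 1 := by rwa [ZMod.card]
  obtain ⟨d, hd⟩ := exists_quadraticExtension hF
  have : Fact (∀ r : ZMod p, r ^ 2 ≠ d + 0 * r) := ⟨hd⟩
  obtain ⟨f, hf⟩ := exists_isBuildingQuadruple_quadratic (d := d) hF
  refine ⟨_, inferInstance, inferInstance, f, ?_, hf⟩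
  rw [Fintype.card_prod, QuadraticAlgebra.fintype_card_eq, ZMod.card]
  ring

theorem isBuildingOrder_pow_four (n : ℕ) (hn : n % 2 = 1) : IsBuildingOrder (n ^ 4) := by
  induction n using induction_on_primes with
  | zero => simp at hn
  | one => simpa using isBuildingOrder_one
  | prime_mul p a hp ih =>
    obtain ⟨h1, h2⟩ := Nat.odd_mul.mp (Nat.odd_iff.mpr hn)
    rw [mul_pow]
    exact (isBuildingOrder_prime_pow_four hp (Nat.odd_iff.mp h1)).mul (ih (Nat.odd_iff.mp h2))

theorem IsPaleyQuadruple.exists_group {H : Type} [AddCommGroup H] [Fintype H]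
    {f : Fin 4 → H → ℚ} {P : H → ℚ} (h : IsPaleyQuadruple f P) :
    ∃ (G : Type) (_ : AddCommGroup G) (_ : Fintype G) (_ : DecidableEq G) (B : Fin 4 → Finset G),
      Fintype.card G = 5 * Fintype.card H ∧ IsTypeHStar 4 B := by
  classical
  obtain ⟨B, hB⟩ := h.exists_isTypeHStar
  exact ⟨Fin 5 × H, inferInstance, inferInstance, inferInstance, B, by simp, hB⟩

theorem IsBuildingOrder.exists_group {N : ℕ} (h : IsBuildingOrder N) :
    ∃ (G : Type) (_ : AddCommGroup G) (_ : Fintype G) (_ : DecidableEq G) (B : Fin 4 → Finset G),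
      Fintype.card G = 5 * N ∧ IsTypeHStar 4 B := by
  obtain ⟨H, _, _, f, rfl, hf⟩ := h
  obtain ⟨g, P, hg⟩ := hf.exists_isPaleyQuadruple
  exact hg.exists_group

end Order

section Plane

theorem exists_balanced_vector {K : Type*} [Fintype K] (hK : Fintype.card K % 2 = 1) :
    ∃ σ : Option K → ℚ, (∀ i, σ i = 1 ∨ σ i = -1) ∧ ∑ i, σ i = 0 := by
  classical
  obtain ⟨k, hk⟩ : ∃ k, Fintype.card K = 2 * k + 1 := ⟨Fintype.card K / 2, by omega⟩
  obtain ⟨s, -, hs⟩ := Finset.exists_subset_card_eq (s := (univ : Finset (Option K))) (n := k + 1)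
    (by rw [card_univ, Fintype.card_option]; omega)
  refine ⟨fun i => 2 * (if i ∈ s then 1 else 0) - 1, fun i => ?_, ?_⟩
  · by_cases h : i ∈ s <;> simp [h]; norm_num
  · rw [sum_sub_distrib, ← mul_sum]
    simp [hs, hk]
    ring

variable {K : Type*} [Field K] [Fintype K] [DecidableEq K]

/-- The signed sum of lines of a balanced vector is of Paley type. -/
theorem gr_lineSum_sq_of_balanced {σ : Option K → ℚ} (hσ : ∀ i, σ i = 1 ∨ σ i = -1)
    (hσ0 : ∑ i, σ i = 0) : gr (lineSum σ fun _ => 1) ^ 2 =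
      (Fintype.card (K × K) : AddMonoidAlgebra ℚ (K × K)) - grJ (K × K) := by
  have h : ∀ i, σ i * σ i = 1 := by
    intro i; rcases hσ i with h | h <;> rw [h] <;> norm_num
  rw [sq, gr_lineSum_mul_lineSum, hσ0]
  simp only [h, map_one, one_mul]
  rw [sum_lineElem]
  simp only [sum_const, card_univ, Fintype.card_option, nsmul_eq_mul, mul_one, mul_zero, zero_sub,
    map_neg, map_natCast, Fintype.card_prod]
  push_cast
  ring

theorem lineSum_one_sign {σ : Option K → ℚ} (hσ : ∀ i, σ i = 1 ∨ σ i = -1) {z : K × K}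
    (hz : z ≠ 0) : lineSum σ (fun _ => 1) z = 1 ∨ lineSum σ (fun _ => 1) z = -1 := by
  obtain ⟨i, c, hc, rfl⟩ := exists_smul_projPt_eq z hz
  rw [lineSum_smul_projPt _ _ _ hc, mul_one]
  exact hσ i

/-- With `P² = |K|² - J`, the functions `δ + P`, `δ + P`, `δ - P`, `δ - P` have autocorrelations
adding up to `4 + 4P²`. -/
theorem exists_isTypeHStar_plane (hK : Fintype.card K % 2 = 1) :
    ∃ B : Fin 4 → Finset (K × K), IsTypeHStar 4 B := by
  obtain ⟨σ, hσ, hσ0⟩ := exists_balanced_vector hK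
  have hsq := gr_lineSum_sq_of_balanced hσ hσ0
  have hneg : ∀ ε : ℚ, (fun z : K × K => (if -z = 0 then 1 else 0) +
      ε * lineSum σ (fun _ => 1) (-z)) =
      fun z => (if z = 0 then 1 else 0) + ε * lineSum σ (fun _ => 1) z := by
    intro ε; funext z
    rw [lineSum_neg _ fun _ => rfl]; simp
  have hgr : ∀ ε : ℚ, gr (fun z : K × K => (if z = 0 then 1 else 0) +
      ε * lineSum σ (fun _ => 1) z) = 1 + algebraMap ℚ _ ε * gr (lineSum σ fun _ => 1) := by
    intro ε
    rw [gr_add (fun z : K × K => if z = 0 then 1 else 0), gr_delta, gr_const_mul]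
  refine ⟨_, isTypeHStar_of_gr (fun (i : Fin 4) z => (if z = 0 then 1 else 0) +
    (![1, 1, -1, -1] : Fin 4 → ℚ) i * lineSum σ (fun _ => 1) z) ?_ ?_⟩
  · intro i z
    by_cases hz : z = 0
    · subst hz
      rw [lineSum_zero, hσ0]; simp
    · rw [if_neg hz]
      rcases lineSum_one_sign hσ hz with h | h <;> rw [h] <;> fin_cases i <;> simp
  · simp only [hneg, hgr]
    rw [Fin.sum_univ_four]
    simp only [Matrix.cons_val, map_neg, map_one]
    linear_combination 4 * hsq

theorem exists_group_twentyFive :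
    ∃ (G : Type) (_ : AddCommGroup G) (_ : Fintype G) (_ : DecidableEq G) (B : Fin 4 → Finset G),
      Fintype.card G = 5 * 5 ∧ IsTypeHStar 4 B := by
  have : Fact (Nat.Prime 5) := ⟨Nat.prime_five⟩
  obtain ⟨B, hB⟩ := exists_isTypeHStar_plane (K := ZMod 5) (by rw [ZMod.card])
  exact ⟨ZMod 5 × ZMod 5, inferInstance, inferInstance, inferInstance, B, by simp [ZMod.card], hB⟩

end Plane

/-! ### Quartic characters -/

section Quartic

theorem GaussianInt.cases_of_pow_four_eq_one {z : GaussianInt} (h : z ^ 4 = 1) :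
    ((z.re = 1 ∨ z.re = -1) ∧ z.im = 0) ∨ (z.re = 0 ∧ (z.im = 1 ∨ z.im = -1)) := by
  have h1 : z.norm = 1 := by
    have h2 : z.norm ^ 4 = 1 := by
      have h3 : (Zsqrtd.normMonoidHom z) ^ 4 = 1 := by rw [← map_pow, h, map_one]
      exact h3
    rcases pow_eq_one_iff_of_ne_zero (by norm_num) |>.mp h2 with h | h
    · exact h
    · have := Zsqrtd.norm_nonneg (by norm_num) z
      omega
  rw [Zsqrtd.norm_def] at h1
  have h4 : z.re ≤ 1 := by nlinarith [mul_self_nonneg z.im]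
  have h5 : -1 ≤ z.re := by nlinarith [mul_self_nonneg z.im]
  have h6 : z.im ≤ 1 := by nlinarith [mul_self_nonneg z.re]
  have h7 : -1 ≤ z.im := by nlinarith [mul_self_nonneg z.re]
  generalize z.re = a at *
  generalize z.im = b at *
  interval_cases a <;> interval_cases b <;> simp_all

variable {E : Type*} [Field E] [Fintype E] [DecidableEq E]

theorem exists_sq_eq_of_qchar_eq_one {x : E} (h : qchar x = 1) : ∃ y, x = y ^ 2 := by
  have hx : x ≠ 0 := by
    rintro rfl; rw [qchar_zero] at h; norm_num at h
  have h1 : quadraticChar E x = 1 := by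
    rw [qchar] at h; exact_mod_cast h
  obtain ⟨y, hy⟩ := (quadraticChar_one_iff_isSquare hx).mp h1
  exact ⟨y, by rw [hy, sq]⟩

/-- The real part `Y` and the imaginary part `Y'` of a quartic character: `Y` is supported on the
nonzero squares, `Y'` on the nonsquares, and their autocorrelations add up to `|E|δ - 1`. -/
theorem exists_quartic_parts (hE : Fintype.card E % 8 = 1) : ∃ Y Y' : E → ℚ,
    (Y 0 = 0 ∧ Y' 0 = 0) ∧ (∀ x, Y (-x) = Y x ∧ Y' (-x) = Y' x) ∧
    (∀ x, x ≠ 0 → (qchar x = 1 ∧ (Y x = 1 ∨ Y x = -1) ∧ Y' x = 0) ∨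
      (qchar x = -1 ∧ Y x = 0 ∧ (Y' x = 1 ∨ Y' x = -1))) ∧
    ∀ z, ∑ x, (Y x * Y (z - x) + Y' x * Y' (z - x)) =
      (if z = 0 then (Fintype.card E : ℚ) else 0) - 1 := by
  have hI : IsPrimitiveRoot (⟨0, 1⟩ : GaussianInt) 4 := by
    refine IsPrimitiveRoot.mk_of_lt _ (by norm_num) (by decide) fun l h0 h4 => ?_
    interval_cases l <;> decide
  obtain ⟨χ, hχ⟩ := MulChar.exists_mulChar_orderOf E (n := 4) (by omega) hI
  have hne : χ ≠ 1 := by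
    rintro rfl; rw [orderOf_one] at hχ; norm_num at hχ
  have hp4 : ∀ x, x ≠ 0 → χ x ^ 4 = 1 := by
    intro x hx
    rw [← MulChar.pow_apply' χ (by norm_num), ← hχ, pow_orderOf_eq_one,
      MulChar.one_apply (isUnit_iff_ne_zero.mpr hx)]
  have hc := fun x hx => GaussianInt.cases_of_pow_four_eq_one (hp4 x hx)
  -- `-1` is a fourth power because `8` divides `|E| - 1`.
  have hneg : χ (-1) = 1 := by
    obtain ⟨c, hc⟩ := exists_sq_eq_of_qchar_eq_one (qchar_neg_one (K := E) (by omega))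
    have hc0 : c ≠ 0 := by
      rintro rfl; norm_num at hc
    obtain ⟨s, hs⟩ := (FiniteField.isSquare_iff
      (ringChar_ne_two_of_card (K := E) rfl (by omega)) hc0).mpr (by
        rw [show Fintype.card E / 2 = 2 * (2 * (Fintype.card E / 8)) by omega, pow_mul, ← hc,
          pow_mul]
        simp)
    have hs0 : s ≠ 0 := by
      rintro rfl; exact hc0 (by simpa using hs)
    rw [hc, hs, ← hp4 s hs0, ← map_pow]
    congr 1; ring
  have hsq : ∀ x, x ≠ 0 → qchar x = 1 → χ x ^ 2 = 1 := by
    intro x hx h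
    obtain ⟨y, rfl⟩ := exists_sq_eq_of_qchar_eq_one h
    rw [map_pow, ← pow_mul, hp4 y (by rintro rfl; simp at hx)]
  have hnsq : ∀ x, x ≠ 0 → qchar x = -1 → χ x ^ 2 ≠ 1 := by
    intro x hx h h1
    have h2 : χ ^ 2 = 1 := by
      refine MulChar.ext fun u => ?_
      rw [MulChar.pow_apply' χ (by norm_num), MulChar.one_apply u.isUnit]
      rcases qchar_sign u.ne_zero with hu | hu
      · exact hsq _ u.ne_zero hu
      · have h3 := hsq (u * x) (mul_ne_zero u.ne_zero hx) (by rw [qchar_mul, hu, h]; norm_num)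
        rwa [map_mul, mul_pow, h1, mul_one] at h3
    have := orderOf_le_of_pow_eq_one (by norm_num) h2
    omega
  have hinv : ∀ x, χ⁻¹ x = star (χ x) := by
    intro x
    by_cases hx : x = 0
    · subst hx; simp [MulChar.map_zero]
    · have h1 : χ x * χ⁻¹ x = 1 := by
        rw [← MulChar.mul_apply, mul_inv_cancel, MulChar.one_apply (isUnit_iff_ne_zero.mpr hx)]
      have h2 : χ x * star (χ x) = 1 := by
        rcases hc x hx with ⟨h | h, h'⟩ | ⟨h', h | h⟩ <;> ext <;> simp [h, h']
      have h3 : χ x ≠ 0 := left_ne_zero_of_mul_eq_one h1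
      exact mul_left_cancel₀ h3 (h1.trans h2.symm)
  refine ⟨fun x => (χ x).re, fun x => (χ x).im, by simp [MulChar.map_zero], fun x => ?_,
    fun x hx => ?_, fun z => ?_⟩
  · have h : χ (-x) = χ x := by rw [← neg_one_mul x, map_mul, hneg, one_mul]
    simp only [h, and_self]
  · rcases hc x hx with ⟨h, h'⟩ | ⟨h', h⟩
    · refine Or.inl ⟨(qchar_sign hx).resolve_right fun hq => hnsq x hx hq ?_, ?_, by simp [h']⟩
      · rcases h with h | h <;> ext <;> simp [sq, h, h']
      · rcases h with h | h <;> simp [h]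
    · refine Or.inr ⟨(qchar_sign hx).resolve_left fun hq => ?_, by simp [h'], ?_⟩
      · have := congrArg Zsqrtd.re (hsq x hx hq)
        rcases h with h | h <;> simp [sq, h, h'] at this
      · rcases h with h | h <;> simp [h]
  · have h1 := congrArg Zsqrtd.re (MulChar.sum_mul_inv_sub hne hneg z)
    let re : GaussianInt →+ ℤ := ⟨⟨Zsqrtd.re, rfl⟩, fun _ _ => rfl⟩
    have h2 : ∑ x, ((χ x).re * (χ (z - x)).re + (χ x).im * (χ (z - x)).im) =
        (if z = 0 then (Fintype.card E : ℤ) else 0) - 1 := by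
      have h3 : re (∑ x, χ x * χ⁻¹ (z - x)) =
          re ((if z = 0 then (Fintype.card E : GaussianInt) else 0) - 1) := h1
      rw [map_sum] at h3
      refine (sum_congr rfl fun x _ => ?_).trans (h3.trans ?_)
      · rw [hinv]
        change _ = (χ x * star (χ (z - x))).re
        simp
      · split_ifs
        · change (((Fintype.card E : ℤ) : GaussianInt) - 1).re = _
          simp
        · rfl
    have h4 := congrArg (fun n : ℤ => (n : ℚ)) h2
    push_cast at h4
    exact h4

end Quartic

section QuarticPlane

variable {K : Type*} [Field K] [Fintype K] [DecidableEq K]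

/-- Transport of functions on a quadratic extension of `K` to the plane `K × K`: the quartic
character of the extension gives `Y` and `Y'`. Each line lies, up to the origin, in one coset of the
nonzero squares, which splits the lines into the two halves that carry `X` and `X'`. -/
theorem exists_isPaleyQuadruple_plane (hK : Fintype.card K % 4 = 1) :
    ∃ (f : Fin 4 → K × K → ℚ) (P : K × K → ℚ), IsPaleyQuadruple f P := by
  have hK2 : Fintype.card K % 2 = 1 := by omega
  obtain ⟨d, hd⟩ := exists_quadraticExtension hK2
  have : Fact (∀ r : K, r ^ 2 ≠ d + 0 * r) := ⟨hd⟩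
  let ι : K × K → QuadraticAlgebra K d 0 := fun z => ⟨z.1, z.2⟩
  have hE : Fintype.card (QuadraticAlgebra K d 0) % 8 = 1 := by
    rw [QuadraticAlgebra.fintype_card_eq, Nat.pow_mod]
    have : Fintype.card K % 8 = 1 ∨ Fintype.card K % 8 = 5 := by omega
    rcases this with h | h <;> rw [h]
  obtain ⟨Y₀, Y₀', ⟨h0, h0'⟩, hev, hval, hconv⟩ :=
    exists_quartic_parts (E := QuadraticAlgebra K d 0) hE
  -- The sign `σ i` tells whether the line `i` consists of squares of the extension.
  let σ : Option K → ℚ := fun i => qchar (ι (projPt i))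
  have hι : ∀ z, ι z = 0 ↔ z = 0 := by
    intro z
    rw [QuadraticAlgebra.ext_iff, Prod.ext_iff]
    rfl
  have hιs : ∀ (c : K) z, ι (c • z) = algebraMap K _ c * ι z := by
    intro c z
    rw [QuadraticAlgebra.algebraMap_eq]
    ext <;> simp [ι]
  have hq : ∀ {c : K}, c ≠ 0 → ∀ i, qchar (ι (c • projPt i)) = σ i := by
    intro c hc i
    rw [hιs, qchar_mul, qchar_algebraMap_quadratic hK2 hc, one_mul]
  have hπ : ∀ i : Option K, projPt i ≠ 0 := by
    rintro (_ | a) <;> simp [projPt]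
  have hσ : ∀ i, σ i = 1 ∨ σ i = -1 := fun i => qchar_sign fun h => hπ i ((hι _).mp h)
  have hσ0 : ∑ i, σ i = 0 := by
    have h1 := sum_qchar_quadratic (d := d) hK2 1
    have h2 : σ none = 1 := by
      have h : ι (projPt none) = algebraMap K _ 1 := rfl
      simp only [σ]
      rw [h, qchar_algebraMap_quadratic hK2 one_ne_zero]
    have h3 : ∀ a, σ (some a) = qchar (⟨a, 1⟩ : QuadraticAlgebra K d 0) := fun a => rfl
    rw [Fintype.sum_option, h2, sum_congr rfl fun a _ => h3 a, h1]
    simp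
  obtain ⟨s, s', hs, hs', hss⟩ := exists_balanced_signs hK hσ hσ0
  obtain ⟨hXX, hX, hX'⟩ := gr_balancedLines hσ0 hs hs' hss
  let X := lineSum s fun _ => 1
  let X' := lineSum s' fun _ => 1
  let Y := fun z => Y₀ (ι z)
  let Y' := fun z => Y₀' (ι z)
  have hYY : gr Y ^ 2 + gr Y' ^ 2 =
      (Fintype.card (K × K) : AddMonoidAlgebra ℚ (K × K)) - grJ (K × K) := by
    rw [sq, sq, gr_mul, gr_mul, ← gr_add]
    have h1 : ∀ z, ∑ x, Y x * Y (z - x) + ∑ x, Y' x * Y' (z - x) =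
        (Fintype.card (K × K) : ℚ) * (if z = 0 then 1 else 0) - 1 := by
      intro z
      rw [← sum_add_distrib]
      refine (Fintype.sum_equiv (QuadraticAlgebra.equivProd d 0).symm _
        (fun x => Y₀ x * Y₀ (ι z - x) + Y₀' x * Y₀' (ι z - x)) fun x => rfl).trans ?_
      rw [hconv, QuadraticAlgebra.fintype_card_eq, if_congr (hι z) rfl rfl, Fintype.card_prod]
      split_ifs <;> push_cast <;> ring
    simp_rw [h1]
    rw [gr_sub (fun z => (Fintype.card (K × K) : ℚ) * (if z = 0 then 1 else 0)), gr_const_mul,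
      gr_delta, grJ, mul_one, map_natCast]
  have hcases : ∀ z, (((X z = 1 ∨ X z = -1) ∧ Y z = 0) ∨ (X z = 0 ∧ (Y z = 1 ∨ Y z = -1))) ∧
      (((X' z = 1 ∨ X' z = -1) ∧ Y' z = 0) ∨ (X' z = 0 ∧ (Y' z = 1 ∨ Y' z = -1))) := by
    intro z
    by_cases hz : z = 0
    · subst hz
      refine ⟨Or.inl ⟨Or.inl ?_, h0⟩, Or.inl ⟨Or.inl ?_, h0'⟩⟩
      · simp only [X, lineSum_zero, hs, mul_one]
      · simp only [X', lineSum_zero, hs', mul_one]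
    · have h1 := hval (ι z) (mt (hι z).mp hz)
      obtain ⟨i, c, hc, rfl⟩ := exists_smul_projPt_eq z hz
      rw [hq hc] at h1
      simp only [X, X', Y, Y', lineSum_smul_projPt _ _ _ hc, mul_one]
      rcases hss i with ⟨a1, a2, a3⟩ | ⟨a1, a2, a3⟩ <;>
        rcases h1 with ⟨b1, b2, b3⟩ | ⟨b1, b2, b3⟩
      · exact ⟨Or.inr ⟨a2, b2⟩, Or.inl ⟨a3, b3⟩⟩
      · rw [a1] at b1; norm_num at b1
      · rw [a1] at b1; norm_num at b1
      · exact ⟨Or.inl ⟨a2, b2⟩, Or.inr ⟨a3, b3⟩⟩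
  have hXe : ∀ z, X (-z) = X z := fun z => lineSum_neg s (fun _ => rfl) z
  have hXe' : ∀ z, X' (-z) = X' z := fun z => lineSum_neg s' (fun _ => rfl) z
  have hYe : ∀ z, Y (-z) = Y z := fun z => (hev (ι z)).1
  have hYe' : ∀ z, Y' (-z) = Y' z := fun z => (hev (ι z)).2
  have hcard : (Fintype.card (K × K) : AddMonoidAlgebra ℚ (K × K)) =
      (Fintype.card K : AddMonoidAlgebra ℚ (K × K)) ^ 2 := by
    rw [Fintype.card_prod]; push_cast; ring
  rw [hcard] at hYY
  change gr X * gr X' = _ at hXX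
  change 2 * gr X ^ 2 = _ at hX
  change 2 * gr X' ^ 2 = _ at hX'
  have hhalf := two_mul_algebraMap_half (K × K)
  refine ⟨![fun z => X z + Y z, fun z => X z - Y z, fun z => X' z + Y' z, fun z => X' z - Y' z],
    lineSum σ fun _ => 1, ?_, ?_, ?_, ?_, ?_, ?_, ?_, ?_, ?_⟩
  · intro i z
    obtain ⟨h1, h2⟩ := hcases z
    fin_cases i
    · rcases h1 with ⟨a | a, b⟩ | ⟨a, b | b⟩ <;> simp [a, b]
    · rcases h1 with ⟨a | a, b⟩ | ⟨a, b | b⟩ <;> simp [a, b]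
    · rcases h2 with ⟨a | a, b⟩ | ⟨a, b | b⟩ <;> simp [a, b]
    · rcases h2 with ⟨a | a, b⟩ | ⟨a, b | b⟩ <;> simp [a, b]
  · intro i z
    fin_cases i <;> simp [hXe, hXe', hYe, hYe']
  · rw [lineSum_zero, hσ0, zero_mul]
  · exact fun z hz => lineSum_one_sign hσ hz
  · exact lineSum_neg _ fun _ => rfl
  · simp only [Matrix.cons_val, gr_add, gr_sub]
    linear_combination 4 * hXX
  · simp only [Matrix.cons_val, gr_add, gr_sub]
    linear_combination algebraMap ℚ (AddMonoidAlgebra ℚ (K × K)) (1 / 2) * (hX + hX') - hYY -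
      (gr X ^ 2 + gr X' ^ 2 - (Fintype.card K : AddMonoidAlgebra ℚ (K × K)) ^ 2 - grJ _) * hhalf
  · simp only [Matrix.cons_val, gr_add, gr_sub, hcard]
    linear_combination hX + hX' + 2 * hYY
  · exact gr_lineSum_sq_of_balanced hσ hσ0

end QuarticPlane

theorem exists_group_of_isPrimePow {q : ℕ} (hq : IsPrimePow q) (h4 : q % 4 = 1) :
    ∃ (G : Type) (_ : AddCommGroup G) (_ : Fintype G) (_ : DecidableEq G) (B : Fin 4 → Finset G),
      Fintype.card G = 5 * q ^ 2 ∧ IsTypeHStar 4 B := by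
  classical
  obtain ⟨p, n, hp, hn, rfl⟩ := hq
  have : Fact p.Prime := ⟨hp.nat_prime⟩
  have : Fintype (GaloisField p n) := Fintype.ofFinite _
  have hK : Fintype.card (GaloisField p n) = p ^ n := by
    rw [← Nat.card_eq_fintype_card, GaloisField.card p n hn.ne']
  obtain ⟨f, P, h⟩ := exists_isPaleyQuadruple_plane (K := GaloisField p n) (by rwa [hK])
  have h1 := h.exists_group
  rwa [Fintype.card_prod, hK, ← sq] at h1

theorem mainTheorem5 (v : ℕ) (hv : v ∈ Phi1 ∪ Phi2 ∪ Phi3) :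
    ∃ (G : Type) (_ : AddCommGroup G) (_ : Fintype G) (_ : DecidableEq G) (B : Fin 4 → Finset G),
      Fintype.card G = 5 * v ∧ IsTypeHStar 4 B := by
  rcases hv with (⟨q, hq, h4, rfl⟩ | ⟨n, hn, rfl⟩ | ⟨n, hn, rfl⟩) | rfl
  · exact exists_group_of_isPrimePow hq h4
  · exact (isBuildingOrder_pow_four n hn).exists_group
  · exact (isBuildingOrder_nine.mul (isBuildingOrder_pow_four n hn)).exists_group
  · exact exists_group_twentyFive
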